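/- Conventions. For $n\in\mathbb N=\{0,1,2,\dots\}$ let $[n]=\{1,\dots,n\}$ and let $\sigma_n$ be the abstract simplex of all subsets of an $n$-element set (so $\sigma_0=\{\varnothing\}$). For a finite simplicial complex $\Delta$ let $d=\dim(\Delta)+1$ be the largest cardinality of a face; its $h$-polynomial is $h(\Delta,x)=\sum_{F\in\Delta}x^{|F|}(1-x)^{d-|F|}$, the empty face being included. A pointed face of $\Delta$ is a pair $(F,v)$ with $F\in\Delta$ and $v\in F$. The antiprism triangulation $\mathrm{sd}_{\mathcal A}(\Delta)$ is the clique complex of the graph on the pointed faces of $\Delta$ in which two distinct pointed faces $(F,v)$, $(F',v')$ are adjacent if $F=F'$, or $F\subsetneq F'$ and $v'\in F'\setminus F$, or $F'\subsetneq F$ and $v\in F\setminus F'$. Put $h_{\mathcal A}(\sigma_n,x)=h(\mathrm{sd}_{\mathcal A}(\sigma_n),x)$. An ordered (set) partition of a finite set $S$ is a sequence $(B_1,\dots,B_m)$ of nonempty, pairwise disjoint sets (blocks) with union $S$. A multi-pointed ordered partition of $S$ is a pair $(\pi,\tau)$, where $\pi=(B_1,\dots,B_m)$ and $\tau=(C_1,\dots,C_m)$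 are ordered partitions of $S$ and of a subset of $S$, respectively, with the same number of blocks, such that $C_i\subseteq B_i$ for every $i\in[m]$. Its weight is $\sum_i|C_i|$, and it is proper if $C_i\subsetneq B_i$ for every $i\in[m]$. A multi-pointed partial ordered partition of $[n]$ is a multi-pointed ordered partition of some subset $S\subseteq[n]$. The excedance set of a permutation $w$ of $[n]$ is $\{i\in[n-1]: w(i)>i\}$. $S(a,b)$ denotes the Stirling numbers of the second kind. Proposition. (a) For every positive integer $n$, $$h_{\mathcal A}(\sigma_n,x)=\sum_{k=0}^{n-1}\binom nk x^k\,h_{\mathcal A}(\sigma_k,1/x).$$ (b) For all $n,k\in\mathbb N$, the coefficient of $x^k$ in $h_{\mathcal A}(\sigma_n,x)$ is equal to each of the following: - the number of proper multi-pointed partial ordered partitions of $[n]$ of weight $k$; - the number of ways to choose a subset $S\subseteq[n]$ and an ordered partition $\pi$ of $S$ and to color $k$ elements of $S$ black and the remaining elements of $S$ white, so that no block of $\pi$ is monochromatic; - the number of ordered partitions $\pi=(B_1,\dots,B_m)$ of $[n]$ for which the union $\bigcup_{i=1}^{\lfloor m/2\rfloor}B_i$ has exactly $k$ elements; - $\binom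 nk$ times the number of permutations of $[n]$ with excedance set equal to $[k]$; - the number $$\binom nk\sum_{j=1}^{k+1}(-1)^{k+1-j}\,j!\,S(k+1,j)\,j^{\,n-k-1}$$ (the exponent $n-k-1$ may be negative). -/

import Mathlib

namespace Antiprism

/-! ### Simplicial complexes and their `h`-polynomials

In Mathlib, an `AbstractSimplicialComplex` on `V` records only its nonempty faces, and every
element of `V` is a vertex of it. The empty face is added in `allFaces`. -/

open Classical in
/-- All faces of a finite simplicial complex, including the empty one. -/
noncomputable def allFaces {V : Type*} [Fintype V] (K : AbstractSimplicialComplex V) :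
    Finset (Finset V) :=
  {F : Finset V | F = ∅ ∨ F ∈ K}

/-- The maximum cardinality of a face, which is the dimension of the complex plus one. -/
noncomputable def rank {V : Type*} [Fintype V] (K : AbstractSimplicialComplex V) : ℕ :=
  (allFaces K).sup Finset.card

/-- The `h`-polynomial `h(K, x) = ∑_{F ∈ K} x^|F| (1 - x)^(d - |F|)`, where `d = dim K + 1`. -/
noncomputable def hPolynomial {V : Type*} [Fintype V] (K : AbstractSimplicialComplex V) :
    Polynomial ℤ :=
  ∑ F ∈ allFaces K, Polynomial.X ^ F.card * (1 - Polynomial.X) ^ (rank K - F.card)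

/-- The clique complex of a simple graph: its nonempty faces are the nonempty finite sets of
pairwise adjacent nodes. -/
def cliqueComplex {V : Type*} (G : SimpleGraph V) : AbstractSimplicialComplex V where
  faces := {F | F.Nonempty ∧ G.IsClique (F : Set V)}
  isRelLowerSet_faces := fun _ hF =>
    ⟨hF.1, fun _ hsub hne => ⟨hne, hF.2.subset (Finset.coe_subset.mpr hsub)⟩⟩
  singleton_mem := fun v => ⟨Finset.singleton_nonempty v, by simp⟩

/-! ### The antiprism triangulation -/

/-- The pointed faces `(F, v)` of `K`: `F` is a face of `K` and `v ∈ F`. -/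
def PointedFace {V : Type*} (K : AbstractSimplicialComplex V) : Type _ :=
  {p : Finset V × V // p.1 ∈ K ∧ p.2 ∈ p.1}

open Classical in
noncomputable instance {V : Type*} [Fintype V] (K : AbstractSimplicialComplex V) :
    Fintype (PointedFace K) :=
  inferInstanceAs (Fintype {p : Finset V × V // p.1 ∈ K ∧ p.2 ∈ p.1})

/-- The graph on pointed faces in which distinct `(F, v)` and `(F', v')` are adjacent if
`F = F'`, or `F ⊊ F'` and `v' ∈ F' ∖ F`, or `F' ⊊ F` and `v ∈ F ∖ F'`. -/
def antiprismGraph {V : Type*} (K : AbstractSimplicialComplex V) :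
    SimpleGraph (PointedFace K) where
  Adj p q := p ≠ q ∧
    (p.1.1 = q.1.1 ∨
      (p.1.1 ⊂ q.1.1 ∧ q.1.2 ∈ q.1.1 ∧ q.1.2 ∉ p.1.1) ∨
      (q.1.1 ⊂ p.1.1 ∧ p.1.2 ∈ p.1.1 ∧ p.1.2 ∉ q.1.1))
  symm := ⟨fun _ _ h => ⟨h.1.symm, h.2.elim (fun e => Or.inl e.symm) (fun e => Or.inr e.symm)⟩⟩
  loopless := ⟨fun _ h => h.1 rfl⟩

/-- The antiprism triangulation of `K`. -/
def antiprismTriangulation {V : Type*} (K : AbstractSimplicialComplex V) :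
    AbstractSimplicialComplex (PointedFace K) :=
  cliqueComplex (antiprismGraph K)

/-- The abstract simplex on the `n`-element vertex set `Fin n`: all subsets are faces. -/
def simplex (n : ℕ) : AbstractSimplicialComplex (Fin n) := ⊤

/-- The `h`-polynomial of the antiprism triangulation of the simplex on `n` vertices. -/
noncomputable def hA (n : ℕ) : Polynomial ℤ :=
  hPolynomial (antiprismTriangulation (simplex n))

/-! ### Ordered partitions -/

/-- The union of a finite sequence of finite sets. -/
def blockUnion {α : Type*} [DecidableEq α] (π : List (Finset α)) : Finset α :=
  π.foldr (· ∪ ·) ∅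

/-- `π` is an ordered partition of `S`: a sequence of nonempty, pairwise disjoint sets whose
union is `S`. -/
def IsOrderedPartition {α : Type*} [DecidableEq α] (S : Finset α) (π : List (Finset α)) : Prop :=
  (∀ B ∈ π, B.Nonempty) ∧ π.Pairwise Disjoint ∧ blockUnion π = S

/-- `(π, τ)` is a multi-pointed ordered partition of `S`: `π = (B₁, …, Bₘ)` and
`τ = (C₁, …, Cₘ)` are ordered partitions of `S` and of a subset of `S`, respectively, with the
same number of blocks and with `Cᵢ ⊆ Bᵢ` for every `i`. -/
def IsMultiPointed {α : Type*} [DecidableEq α] (S : Finset α)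
    (φ : List (Finset α) × List (Finset α)) : Prop :=
  IsOrderedPartition S φ.1 ∧ (∃ T ⊆ S, IsOrderedPartition T φ.2) ∧
    List.Forall₂ (fun C B => C ⊆ B) φ.2 φ.1

/-- `(π, τ)` is proper if each `Cᵢ` is a proper subset of `Bᵢ`. -/
def IsProper {α : Type*} (φ : List (Finset α) × List (Finset α)) : Prop :=
  List.Forall₂ (fun C B => C ⊂ B) φ.2 φ.1

/-- The weight of `(π, τ)`: the total number of chosen elements. -/
def weight {α : Type*} (φ : List (Finset α) × List (Finset α)) : ℕ :=
  (φ.2.map Finset.card).sum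

/-- The proper multi-pointed partial ordered partitions of an `n`-element set of weight `k`.
They are determined by `(π, τ)`, since the underlying set `S` is the union of `π`. -/
def properMultiPointed (n k : ℕ) : Set (List (Finset (Fin n)) × List (Finset (Fin n))) :=
  {φ | (∃ S : Finset (Fin n), IsMultiPointed S φ) ∧ IsProper φ ∧ weight φ = k}

/-- A block is monochromatic if all its elements are black or all are white; `b` is the set of
black elements. -/
def IsMonochromatic {α : Type*} (b B : Finset α) : Prop :=
  (∀ x ∈ B, x ∈ b) ∨ (∀ x ∈ B, x ∉ b)

/-- The triples `(S, π, b)` of a subset `S` of an `n`-element set, an ordered partition `π` of `S`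
and a colouring of `S` with `k` black elements (`b` is the set of these, the others are white)
such that no block of `π` is monochromatic. -/
def colouredPartitions (n k : ℕ) :
    Set (Finset (Fin n) × List (Finset (Fin n)) × Finset (Fin n)) :=
  {t | IsOrderedPartition t.1 t.2.1 ∧ t.2.2 ⊆ t.1 ∧ t.2.2.card = k ∧
    ∀ B ∈ t.2.1, ¬ IsMonochromatic t.2.2 B}

/-- The ordered partitions `(B₁, …, Bₘ)` of an `n`-element set such that the union of the first
`⌊m/2⌋` blocks has exactly `k` elements. -/
def halfUnionPartitions (n k : ℕ) : Set (List (Finset (Fin n))) :=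
  {π | IsOrderedPartition Finset.univ π ∧ (blockUnion (π.take (π.length / 2))).card = k}

/-! ### Excedances -/

/-- The excedance set of a permutation of `{1, …, n}`, where `i : Fin n` stands for the number
`i + 1`. (The condition `i + 1 ≤ n - 1` holds automatically if `w i > i`.) -/
def excedanceSet {n : ℕ} (w : Equiv.Perm (Fin n)) : Finset ℕ :=
  (Finset.univ.filter (fun i : Fin n => i < w i)).image (fun i : Fin n => (i : ℕ) + 1)

/-- The number of permutations of `{1, …, n}` with excedance set equal to `{1, …, k}`. -/
def excedanceCount (n k : ℕ) : ℕ :=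
  (Finset.univ.filter (fun w : Equiv.Perm (Fin n) => excedanceSet w = Finset.Icc 1 k)).card

end Antiprism

namespace Antiprism

open Finset

/-! Everything in (b) equals `n.choose k * hCoeff k (n - k)`, where `hCoeff k b` is the sum over `j`
of (ordered partitions of a `k`-set into `j` blocks) times (ordered partitions into `j` blocks of
subsets of a `b`-set).

Three counts are direct. In a colouring without monochromatic blocks, the black and the white parts
of the blocks are two ordered partitions with the same number `j` of blocks. In a proper
multi-pointed partition the chosen elements are the black ones. Cutting an ordered partition in the
middle leaves `j` blocks on the left and `j` or `j + 1` on the right, and `partialSurjCount_eq` adds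
up the two cases.

Permutations whose excedances lie in a given set are counted by a product
(`excedanceSubsetCount_succ`). Inclusion-exclusion over subsets of `range k` gives the alternating
sum in `sum_neg_one_pow_mul_partialSurjCount_mul_pow`, which is also the Stirling sum with `j = s +
1`; a binomial inversion identifies it with `hCoeff`.

For the `h`-polynomial, the sets occurring in a face of the triangulation form a chain. Peeling off
the largest set, with its points `C`, leaves a face over the simplex on the rest of that set. This
yields the recursion `faceSum_eq`, which determines the polynomials. For exponential generating
functions it reads `H = e^((1-x)t) + H (e^t - e^((1-x)t))`, that is, `H = e^t / (1 - (e^(xt) -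
1)(e^t - 1))`. Expanding the geometric series shows that the numbers above solve it (`hValue_rec`).

Part (a) is the comparison of coefficients supplied by `hCoeff_succ_right`. -/

/-! ### Counting surjections -/

/-- The number `j! S(n, j)` of ordered partitions of an `n`-element set into `j` blocks. -/
def surjCount (n j : ℕ) : ℕ := j.factorial * n.stirlingSecond j

/-- The number `j! S(n + 1, j + 1)` of ordered partitions into `j` blocks of the subsets of an
`n`-element set. -/
def partialSurjCount (n j : ℕ) : ℕ := j.factorial * (n + 1).stirlingSecond (j + 1)

/-- The coefficient of `x ^ k` in `hA (k + b)`, divided by `(k + b).choose k`. -/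
def hCoeff (k b : ℕ) : ℕ := ∑ j ∈ range (k + 1), surjCount k j * partialSurjCount b j

/-- The complement of the partitioned subset is either empty or serves as one more block. -/
theorem partialSurjCount_eq (n j : ℕ) :
    partialSurjCount n j = surjCount n j + surjCount n (j + 1) := by
  simp only [partialSurjCount, surjCount, Nat.stirlingSecond_succ_succ, Nat.factorial_succ]
  ring

@[simp] theorem surjCount_zero_zero : surjCount 0 0 = 1 := rfl

@[simp] theorem surjCount_zero_succ (j : ℕ) : surjCount 0 (j + 1) = 0 := by simp [surjCount]

@[simp] theorem surjCount_succ_zero (n : ℕ) : surjCount (n + 1) 0 = 0 := by simp [surjCount]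

theorem surjCount_succ_succ (n j : ℕ) :
    surjCount (n + 1) (j + 1) = (j + 1) * (surjCount n j + surjCount n (j + 1)) := by
  simp only [surjCount, Nat.stirlingSecond_succ_succ, Nat.factorial_succ]
  ring

theorem surjCount_eq_zero {n j : ℕ} (h : n < j) : surjCount n j = 0 := by
  simp [surjCount, Nat.stirlingSecond_eq_zero_of_lt h]

theorem partialSurjCount_eq_zero {n j : ℕ} (h : n < j) : partialSurjCount n j = 0 := by
  simp [partialSurjCount, Nat.stirlingSecond_eq_zero_of_lt (Nat.succ_lt_succ h)]

@[simp] theorem partialSurjCount_zero (n : ℕ) : partialSurjCount n 0 = 1 := by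
  simp [partialSurjCount, Nat.stirlingSecond_one_right]

theorem partialSurjCount_succ_succ (n j : ℕ) :
    partialSurjCount (n + 1) (j + 1) =
      (j + 2) * partialSurjCount n (j + 1) + (j + 1) * partialSurjCount n j := by
  simp only [partialSurjCount, Nat.stirlingSecond_succ_succ (n + 1) (j + 1), Nat.factorial_succ]
  ring

theorem sum_choose_mul_succ (f : ℕ → ℕ) (n : ℕ) :
    ∑ r ∈ range (n + 2), (n + 1).choose r * f r =
      ∑ r ∈ range (n + 1), n.choose r * (f r + f (r + 1)) := by
  rw [sum_range_succ']
  simp only [Nat.choose_succ_succ, add_mul, mul_add, sum_add_distrib]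
  have h := sum_range_succ' (fun r => n.choose r * f r) (n + 1)
  rw [sum_range_succ _ (n + 1)] at h
  simp only [Nat.succ_eq_add_one, Nat.choose_succ_self, zero_mul, add_zero, Nat.choose_zero_right,
    one_mul] at h ⊢
  omega

theorem sum_choose_mul_surjCount (n j : ℕ) :
    ∑ r ∈ range (n + 1), n.choose r * surjCount r j = partialSurjCount n j := by
  induction n generalizing j with
  | zero => cases j <;> simp [partialSurjCount_eq]
  | succ n ih =>
    rw [sum_choose_mul_succ (fun r => surjCount r j)]
    simp only [mul_add, sum_add_distrib, ih]
    cases j with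
    | zero => simp
    | succ j =>
      simp only [surjCount_succ_succ, partialSurjCount_succ_succ, mul_left_comm _ (j + 1), mul_add,
        ← mul_sum, sum_add_distrib, ih]
      ring

/-- The nonempty complement of a proper subset becomes an additional block. -/
theorem sum_choose_mul_surjCount_lt (n j : ℕ) :
    ∑ r ∈ range n, n.choose r * surjCount r j = surjCount n (j + 1) := by
  have h := sum_choose_mul_surjCount n j
  rw [sum_range_succ, partialSurjCount_eq, Nat.choose_self] at h
  omega

/-- The order of summation in `hCoeff` may be extended arbitrarily. -/
theorem hCoeff_eq_sum_range {k b N : ℕ} (h : k < N) :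
    hCoeff k b = ∑ j ∈ range N, surjCount k j * partialSurjCount b j := by
  refine sum_subset (range_subset_range.2 h) fun j _ hj => ?_
  rw [surjCount_eq_zero (by simpa using hj), zero_mul]

/-- Summing over `i` first turns the right side into a sum of `surjCount (b + 1) (j + 1) *
partialSurjCount k j`. Once `partialSurjCount` is split on both sides, they differ only by an index
shift, harmless because `surjCount (b + 1) 0 = 0`. -/
theorem hCoeff_succ_right (k b : ℕ) :
    hCoeff k (b + 1) = ∑ i ∈ range (b + 1), (b + 1).choose i * hCoeff i k := by
  have h1 : ∑ i ∈ range (b + 1), (b + 1).choose i * hCoeff i k =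
      ∑ j ∈ range (k + b + 2), surjCount (b + 1) (j + 1) * partialSurjCount k j := by
    simp only [← sum_choose_mul_surjCount_lt, sum_mul]
    rw [sum_comm]
    refine sum_congr rfl fun i hi => ?_
    rw [hCoeff_eq_sum_range (N := k + b + 2) (by have := mem_range.1 hi; omega), mul_sum]
    exact sum_congr rfl fun j _ => (mul_assoc _ _ _).symm
  rw [h1, hCoeff_eq_sum_range (N := k + b + 2) (by omega)]
  simp only [partialSurjCount_eq, mul_add, sum_add_distrib]
  have h2 := sum_range_succ' (fun j => surjCount k j * surjCount (b + 1) j) (k + b + 2)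
  rw [sum_range_succ, surjCount_eq_zero (show k < k + b + 2 by omega)] at h2
  simp only [surjCount_succ_zero, mul_zero, zero_mul, add_zero] at h2
  rw [h2, add_comm]
  simp only [mul_comm]

/-- Combinatorially, maps from a `b`-set to `s + 1` points are sorted by which `j` points other than
a distinguished one are hit. -/
theorem succ_pow_eq_sum (s b : ℕ) :
    (s + 1) ^ b = ∑ j ∈ range (b + 1), s.choose j * partialSurjCount b j := by
  induction b with
  | zero => simp
  | succ b ih =>
    have h1 : (∑ j ∈ range (b + 1), s.choose j * partialSurjCount b j) * (s + 1) =
        ∑ j ∈ range (b + 1), s.choose j * ((j + 1) * partialSurjCount b j) +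
        ∑ j ∈ range (b + 1), s.choose (j + 1) * ((j + 1) * partialSurjCount b j) := by
      rw [sum_mul, ← sum_add_distrib]
      refine sum_congr rfl fun j _ => ?_
      have := Nat.add_one_mul_choose_eq s j
      rw [Nat.choose_succ_succ] at this
      linear_combination (partialSurjCount b j) * this
    have h2 := sum_range_succ' (fun j => s.choose j * ((j + 1) * partialSurjCount b j)) (b + 1)
    rw [sum_range_succ, partialSurjCount_eq_zero (Nat.lt_succ_self b)] at h2
    rw [pow_succ, ih, h1, sum_range_succ' _ (b + 1)]
    simp only [partialSurjCount_succ_succ, mul_add, sum_add_distrib]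
    simp only [mul_zero, add_zero, zero_add, partialSurjCount_zero, mul_one, add_assoc,
      one_add_one_eq_two] at h2 ⊢
    rw [h2]
    ring

/-- In generating functions this is `∑ C(s, j) y^s = y^j / (1 - y)^(j+1)` at `y = 1 - e^t`;
multiplied by `e^t` it gives `(e^(-t) - 1)^j`. The proof is by induction on `k`. -/
theorem sum_neg_one_pow_mul_choose_mul_partialSurjCount (k j : ℕ) :
    ∑ s ∈ range (k + 1), (-1 : ℤ) ^ s * s.choose j * partialSurjCount k s =
      (-1) ^ k * surjCount k j := by
  induction k generalizing j with
  | zero => cases j <;> simp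
  | succ k ih =>
    -- Summation by parts: the recurrence for `partialSurjCount` is moved onto the binomial
    -- coefficients.
    have key : ∑ s ∈ range (k + 2), (-1 : ℤ) ^ s * s.choose j * partialSurjCount (k + 1) s =
        ∑ s ∈ range (k + 1), (-1 : ℤ) ^ s * partialSurjCount k s *
          ((s + 1) * s.choose j - (s + 1) * (s + 1).choose j) := by
      have h1 : ∑ s ∈ range (k + 1), (-1 : ℤ) ^ s * partialSurjCount k s *
            ((s + 1) * s.choose j - (s + 1) * (s + 1).choose j) =
          ∑ s ∈ range (k + 1), (-1 : ℤ) ^ s * s.choose j * ((s + 1) * partialSurjCount k s) +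
          ∑ s ∈ range (k + 1),
            (-1 : ℤ) ^ (s + 1) * (s + 1).choose j * ((s + 1) * partialSurjCount k s) := by
        rw [← sum_add_distrib]
        exact sum_congr rfl fun s _ => by ring
      have h2 := sum_range_succ' (fun s =>
        (-1 : ℤ) ^ s * s.choose j * ((s + 1) * partialSurjCount k s)) (k + 1)
      rw [sum_range_succ, partialSurjCount_eq_zero (Nat.lt_succ_self k)] at h2
      simp only [Nat.cast_zero, mul_zero, add_zero, zero_add, partialSurjCount_zero,
        Nat.cast_one, mul_one] at h2
      rw [h1, h2, sum_range_succ' _ (k + 1), add_right_comm, ← sum_add_distrib]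
      simp only [partialSurjCount_zero, Nat.cast_one, mul_one, partialSurjCount_succ_succ]
      congr 1
      refine sum_congr rfl fun s _ => ?_
      push_cast
      ring
    rw [key]
    cases j with
    | zero => simp
    | succ j =>
      have e : ∀ s : ℕ, ((s : ℤ) + 1) * s.choose (j + 1) - (s + 1) * (s + 1).choose (j + 1) =
          -((j + 1) * (s.choose j + s.choose (j + 1))) := by
        intro s
        have h := Nat.add_one_mul_choose_eq s j
        rw [Nat.choose_succ_succ] at h ⊢
        zify at h
        push_cast
        linear_combination -h
      simp only [e, surjCount_succ_succ]
      have h1 := ih j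
      have h2 := ih (j + 1)
      push_cast
      rw [pow_succ, show (-1 : ℤ) ^ k * -1 * ((j + 1) * (surjCount k j + surjCount k (j + 1))) =
        -(j + 1) * ((-1) ^ k * surjCount k j + (-1) ^ k * surjCount k (j + 1)) by ring, ← h1, ← h2,
        ← sum_add_distrib, mul_sum]
      exact sum_congr rfl fun s _ => by ring

/-- Expand the power in the basis `s.choose j` and exchange sums; the inner alternating sum is then
`surjCount k j` up to sign. -/
theorem sum_neg_one_pow_mul_partialSurjCount_mul_pow (k b : ℕ) :
    ∑ s ∈ range (k + 1), (-1 : ℤ) ^ (k - s) * partialSurjCount k s * (s + 1) ^ b = hCoeff k b := by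
  have h1 : ∀ s ∈ range (k + 1), (-1 : ℤ) ^ (k - s) * partialSurjCount k s * (s + 1) ^ b =
      ∑ j ∈ range (k + b + 1), (-1) ^ k * (partialSurjCount b j *
        ((-1 : ℤ) ^ s * s.choose j * partialSurjCount k s)) := by
    intro s hs
    have hs' : s ≤ k := Nat.lt_succ_iff.1 (mem_range.1 hs)
    have e : ((s : ℤ) + 1) ^ b = ∑ j ∈ range (k + b + 1), (s.choose j : ℤ) * partialSurjCount b j := by
      have := succ_pow_eq_sum s b
      zify at this
      rw [this]
      refine sum_subset (range_subset_range.2 (by omega)) fun j _ hj => ?_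
      rw [partialSurjCount_eq_zero (by simpa using hj), Nat.cast_zero, mul_zero]
    have e2 : (-1 : ℤ) ^ (k - s) = (-1) ^ k * (-1) ^ s := by
      rw [← pow_add]
      exact (neg_one_pow_congr (by rw [Nat.even_sub hs', Nat.even_add]))
    rw [e, e2, mul_sum]
    exact sum_congr rfl fun j _ => by ring
  rw [sum_congr rfl h1, sum_comm]
  simp only [← mul_sum, sum_neg_one_pow_mul_choose_mul_partialSurjCount]
  rw [hCoeff_eq_sum_range (N := k + b + 1) (by omega), mul_sum]
  push_cast
  refine sum_congr rfl fun j _ => ?_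
  have : (-1 : ℤ) ^ k * (-1) ^ k = 1 := by rw [← mul_pow]; simp
  linear_combination (partialSurjCount b j : ℤ) * surjCount k j * this

/-! ### Permutations with prescribed excedances -/

/-- The number of permutations of `{0, …, n - 1}` all of whose excedances are in `A`. -/
def excedanceSubsetCount (n : ℕ) (A : Finset ℕ) : ℕ :=
  #{w : Equiv.Perm (Fin n) | ∀ i : Fin n, (i : ℕ) ∉ A → w i ≤ i}

theorem excedanceSubsetCount_zero (A : Finset ℕ) : excedanceSubsetCount 0 A = 1 := by
  simp [excedanceSubsetCount]

theorem excedanceSubsetCount_congr {n : ℕ} {A B : Finset ℕ} (h : ∀ i < n, i ∈ A ↔ i ∈ B) :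
    excedanceSubsetCount n A = excedanceSubsetCount n B := by
  unfold excedanceSubsetCount
  congr 1
  ext w
  simp only [mem_filter_univ]
  exact forall_congr' fun i => by rw [h i i.2]

/-- A permutation of `Fin (n + 1)` arises from one of `Fin n` by inserting the largest element
into a cycle. -/
def insertLastEquiv (n : ℕ) :
    Equiv.Perm (Fin (n + 1)) ≃ Option (Fin n) × Equiv.Perm (Fin n) :=
  finSuccEquivLast.permCongr.trans Equiv.Perm.decomposeOption

theorem insertLastEquiv_symm_castSucc (n : ℕ) (p : Option (Fin n) × Equiv.Perm (Fin n))
    (i : Fin n) : (insertLastEquiv n).symm p i.castSucc =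
      if p.1 = some (p.2 i) then Fin.last n else (p.2 i).castSucc := by
  have : (insertLastEquiv n).symm p i.castSucc =
      finSuccEquivLast.symm (Equiv.swap none p.1 (some (p.2 i))) := by
    simp [insertLastEquiv, Equiv.permCongr_symm, Equiv.permCongr_apply]
  rw [this]
  split_ifs with h
  · rw [h, Equiv.swap_apply_right, finSuccEquivLast_symm_none]
  · rw [Equiv.swap_apply_of_ne_of_ne (by simp) (Ne.symm h), finSuccEquivLast_symm_some]

theorem insertLastEquiv_symm_le_iff (n : ℕ) (A : Finset ℕ)
    (p : Option (Fin n) × Equiv.Perm (Fin n)) :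
    (∀ i : Fin (n + 1), (i : ℕ) ∉ A → (insertLastEquiv n).symm p i ≤ i) ↔
      (∀ i : Fin n, (i : ℕ) ∉ A → p.2 i ≤ i) ∧ ∀ i : Fin n, (i : ℕ) ∉ A → p.1 ≠ some (p.2 i) := by
  rw [Fin.forall_fin_succ']
  simp only [Fin.val_castSucc, insertLastEquiv_symm_castSucc, Fin.le_last, implies_true, and_true,
    ← forall_and]
  refine forall_congr' fun i => ?_
  refine imp_congr_right fun _ => ?_
  split_ifs with h
  · simp only [h, ne_eq, not_true, and_false, iff_false, not_le]
    exact Fin.castSucc_lt_last i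
  · simp [h]

/-- The new largest element is either fixed or becomes the image of some `i < n`. In the second case
`i` turns into an excedance, so it must lie in `A`. Whether `n` itself lies in `A` does not matter.
-/
theorem excedanceSubsetCount_succ (n : ℕ) (A : Finset ℕ) :
    excedanceSubsetCount (n + 1) A =
      (#{i ∈ range n | i ∈ A} + 1) * excedanceSubsetCount n A := by
  have h1 : excedanceSubsetCount (n + 1) A =
      #{p : Option (Fin n) × Equiv.Perm (Fin n) | (∀ i : Fin n, (i : ℕ) ∉ A → p.2 i ≤ i) ∧
        ∀ i : Fin n, (i : ℕ) ∉ A → p.1 ≠ some (p.2 i)} := by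
    refine card_equiv (insertLastEquiv n) fun w => ?_
    rw [mem_filter_univ, mem_filter_univ, ← insertLastEquiv_symm_le_iff, Equiv.symm_apply_apply]
  have h2 : ∀ e : Equiv.Perm (Fin n),
      #{o : Option (Fin n) | ∀ i : Fin n, (i : ℕ) ∉ A → o ≠ some (e i)} =
        #{i ∈ range n | i ∈ A} + 1 := by
    intro e
    have : ({o : Option (Fin n) | ∀ i : Fin n, (i : ℕ) ∉ A → o ≠ some (e i)} : Finset _) =
        insertNone (({i : Fin n | (i : ℕ) ∈ A} : Finset (Fin n)).map e.toEmbedding) := by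
      ext o
      cases o with
      | none => simp
      | some x =>
        simp only [mem_filter_univ, ne_eq, Option.some.injEq, some_mem_insertNone, mem_map_equiv]
        constructor
        · intro h
          by_contra hx
          exact h _ hx (by simp)
        · rintro h i hi rfl
          exact hi (by simpa using h)
    rw [this, card_insertNone, card_map]
    congr 1
    refine card_bij (fun i _ => (i : ℕ)) (by simp) (fun a _ b _ h => Fin.ext h) ?_
    intro b hb
    simp only [mem_filter, mem_range] at hb
    exact ⟨⟨b, hb.1⟩, by simpa using hb.2, rfl⟩
  rw [h1, excedanceSubsetCount, card_filter, ← univ_product_univ, sum_product_right,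
    card_eq_sum_ones (filter _ (univ : Finset (Equiv.Perm (Fin n)))), sum_filter, mul_sum]
  refine sum_congr rfl fun e _ => ?_
  rw [← card_filter]
  split_ifs with h
  · rw [mul_one, ← h2 e]
    exact congrArg card (filter_congr fun x _ => and_iff_right h)
  · simp [h]

theorem excedanceSubsetCount_add {k : ℕ} {A : Finset ℕ} (hA : A ⊆ range k) (b : ℕ) :
    excedanceSubsetCount (k + b) A = (#A + 1) ^ b * excedanceSubsetCount k A := by
  induction b with
  | zero => simp
  | succ b ih =>
    rw [← add_assoc, excedanceSubsetCount_succ, ih, pow_succ']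
    have : ({i ∈ range (k + b) | i ∈ A} : Finset ℕ) = A := by
      ext i
      simp only [mem_filter, mem_range, and_iff_right_iff_imp]
      intro hi
      have := mem_range.1 (hA hi)
      omega
    rw [this, mul_assoc]

/-- Splitting the sets `A` by whether they contain the largest element reproduces the recurrence
`partialSurjCount_succ_succ`. -/
theorem sum_excedanceSubsetCount (k s : ℕ) :
    ∑ A ∈ powersetCard s (range k), excedanceSubsetCount k A = partialSurjCount k s := by
  induction k generalizing s with
  | zero =>
    cases s with
    | zero => simp [excedanceSubsetCount_zero]
    | succ s => simp [partialSurjCount_eq]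
  | succ k ih =>
    have h1 : ∀ s, ∀ A ∈ powersetCard s (range k),
        excedanceSubsetCount (k + 1) A = (s + 1) * excedanceSubsetCount k A := by
      intro s A hA
      rw [mem_powersetCard] at hA
      rw [excedanceSubsetCount_add hA.1, hA.2, pow_one]
    have h2 : ∀ s, ∀ A ∈ powersetCard s (range k),
        excedanceSubsetCount (k + 1) (insert k A) = (s + 1) * excedanceSubsetCount k A := by
      intro s A hA
      rw [← h1 s A hA, excedanceSubsetCount_succ, excedanceSubsetCount_succ]
      congr 1
      · congr 2
        refine filter_congr fun i hi => ?_
        simp [(mem_range.1 hi).ne]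
      · exact excedanceSubsetCount_congr fun i hi => by simp [hi.ne]
    cases s with
    | zero => simpa using (h1 0 ∅ (by simp)).trans (by simpa using ih 0)
    | succ s =>
      rw [range_add_one, powersetCard_succ_insert (by simp), sum_union, sum_image,
        sum_congr rfl (h1 _), sum_congr rfl (h2 _), ← mul_sum, ← mul_sum, ih, ih,
        partialSurjCount_succ_succ]
      · intro A hA B hB h
        have hA' : k ∉ A := fun h => by simpa using (mem_powersetCard.1 hA).1 h
        have hB' : k ∉ B := fun h => by simpa using (mem_powersetCard.1 hB).1 h
        rw [← erase_insert hA', h, erase_insert hB']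
      · rw [disjoint_left]
        intro A hA hA'
        obtain ⟨B, _, rfl⟩ := mem_image.1 hA'
        simpa using (mem_powersetCard.1 hA).1 (mem_insert_self k B)

theorem excedanceSet_eq_Icc_iff {n k : ℕ} (w : Equiv.Perm (Fin n)) :
    excedanceSet w = Icc 1 k ↔ ({i | i < w i} : Finset (Fin n)).image Fin.val = range k := by
  have h : excedanceSet w = (({i | i < w i} : Finset (Fin n)).image Fin.val).image (· + 1) := by
    rw [image_image]
    rfl
  have h2 : Icc 1 k = (range k).image (· + 1) := by
    ext i
    simp only [mem_Icc, mem_image, mem_range]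
    exact ⟨fun h => ⟨i - 1, by omega, by omega⟩, by rintro ⟨j, hj, rfl⟩; omega⟩
  rw [h, h2]
  exact (image_injective (add_left_injective 1)).eq_iff

theorem sum_excedance_indicator (k : ℕ) (E : Finset ℕ) :
    ∑ A ∈ (range k).powerset, (-1 : ℤ) ^ (k - #A) * (if E ⊆ A then 1 else 0) =
      if E = range k then 1 else 0 := by
  simp only [mul_ite, mul_one, mul_zero, ← sum_filter]
  by_cases hE : E ⊆ range k
  -- Complementation in `range k` reduces this to the alternating sum over a full power set.
  · have h : ∑ A ∈ (range k).powerset with E ⊆ A, (-1 : ℤ) ^ (k - #A) =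
        ∑ B ∈ (range k \ E).powerset, (-1 : ℤ) ^ #B := by
      refine sum_nbij' (range k \ ·) (range k \ ·) ?_ ?_ ?_ ?_ ?_
      · intro A hA
        simp only [mem_filter, mem_powerset] at hA ⊢
        exact sdiff_subset_sdiff subset_rfl hA.2
      · intro B hB
        simp only [mem_filter, mem_powerset] at hB ⊢
        refine ⟨sdiff_subset, fun x hx => mem_sdiff.2 ⟨hE hx, fun hxB => ?_⟩⟩
        exact (mem_sdiff.1 (hB hxB)).2 hx
      · intro A hA
        simp only [mem_filter, mem_powerset] at hA
        exact Finset.sdiff_sdiff_eq_self hA.1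
      · intro B hB
        exact Finset.sdiff_sdiff_eq_self ((mem_powerset.1 hB).trans sdiff_subset)
      · intro A hA
        simp only [mem_filter, mem_powerset] at hA
        rw [card_sdiff_of_subset hA.1, card_range]
    rw [h, sum_powerset_neg_one_pow_card]
    simp only [sdiff_eq_empty_iff_subset]
    congr 1
    exact propext ⟨fun h => subset_antisymm hE h, fun h => h.ge⟩
  · rw [if_neg fun h => hE h.le, sum_eq_zero]
    intro A hA
    simp only [mem_filter, mem_powerset] at hA
    exact absurd (hA.2.trans hA.1) hE

theorem excedanceCount_eq (k b : ℕ) : excedanceCount (k + b) k = hCoeff k b := by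
  zify
  rw [← sum_neg_one_pow_mul_partialSurjCount_mul_pow]
  have h1 : (excedanceCount (k + b) k : ℤ) = ∑ A ∈ (range k).powerset,
      (-1 : ℤ) ^ (k - #A) * excedanceSubsetCount (k + b) A := by
    simp only [excedanceCount, excedanceSubsetCount, card_filter, Nat.cast_sum, mul_sum]
    rw [sum_comm]
    refine sum_congr rfl fun w _ => ?_
    simp only [excedanceSet_eq_Icc_iff, Nat.cast_ite, Nat.cast_one, Nat.cast_zero]
    rw [← sum_excedance_indicator]
    refine sum_congr rfl fun A _ => ?_
    congr 2
    simp only [image_subset_iff, mem_filter_univ, eq_iff_iff]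
    exact forall_congr' fun i => 
      ⟨fun h hA => not_lt.1 fun hl => hA (h hl), fun h hl => by_contra fun hA => (h hA).not_gt hl⟩
  rw [h1, sum_powerset, card_range]
  refine sum_congr rfl fun s _ => ?_
  rw [← sum_excedanceSubsetCount, Nat.cast_sum, mul_sum, sum_mul]
  refine sum_congr rfl fun A hA => ?_
  rw [mem_powersetCard] at hA
  rw [excedanceSubsetCount_add hA.1, hA.2]
  push_cast
  ring

/-! ### Counting ordered partitions -/

section OrderedPartitions

variable {α : Type*} [DecidableEq α]

@[simp] theorem blockUnion_nil : blockUnion ([] : List (Finset α)) = ∅ := rfl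

@[simp] theorem blockUnion_cons (B : Finset α) (π : List (Finset α)) :
    blockUnion (B :: π) = B ∪ blockUnion π := rfl

theorem mem_blockUnion {π : List (Finset α)} {x : α} : x ∈ blockUnion π ↔ ∃ B ∈ π, x ∈ B := by
  induction π with
  | nil => simp
  | cons B π ih => simp [ih]

theorem disjoint_blockUnion_right {π : List (Finset α)} {B : Finset α} :
    Disjoint B (blockUnion π) ↔ ∀ C ∈ π, Disjoint B C := by
  simp only [disjoint_left, mem_blockUnion]
  exact ⟨fun h C hC x hx hxC => h hx ⟨C, hC, hxC⟩, fun h x hx ⟨C, hC, hxC⟩ => h C hC hx hxC⟩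

theorem isOrderedPartition_nil {S : Finset α} : IsOrderedPartition S [] ↔ S = ∅ := by
  simp [IsOrderedPartition, eq_comm]

theorem isOrderedPartition_blockUnion {π : List (Finset α)} :
    IsOrderedPartition (blockUnion π) π ↔ (∀ B ∈ π, B.Nonempty) ∧ π.Pairwise Disjoint := by
  simp [IsOrderedPartition]

theorem IsOrderedPartition.blockUnion_eq {S : Finset α} {π : List (Finset α)}
    (h : IsOrderedPartition S π) : blockUnion π = S := h.2.2

theorem isOrderedPartition_cons {S B : Finset α} {π : List (Finset α)} :
    IsOrderedPartition S (B :: π) ↔ (B.Nonempty ∧ B ⊆ S) ∧ IsOrderedPartition (S \ B) π := by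
  simp only [IsOrderedPartition, List.forall_mem_cons, List.pairwise_cons,
    ← disjoint_blockUnion_right, blockUnion_cons]
  constructor
  · rintro ⟨⟨h1, h2⟩, ⟨h3, h4⟩, rfl⟩
    exact ⟨⟨h1, subset_union_left⟩, h2, h4, by rw [union_sdiff_cancel_left h3]⟩
  · rintro ⟨⟨h1, h2⟩, h3, h4, h5⟩
    rw [h5]
    exact ⟨⟨h1, h3⟩, ⟨disjoint_sdiff, h4⟩, union_sdiff_of_subset h2⟩

theorem isOrderedPartition_append {S : Finset α} {π ρ : List (Finset α)} :
    IsOrderedPartition S (π ++ ρ) ↔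
      blockUnion π ⊆ S ∧ IsOrderedPartition (blockUnion π) π ∧
        IsOrderedPartition (S \ blockUnion π) ρ := by
  induction π generalizing S with
  | nil => simp [isOrderedPartition_nil]
  | cons B π ih =>
    rw [List.cons_append, isOrderedPartition_cons, ih, isOrderedPartition_cons]
    have e : (S \ B) \ blockUnion π = S \ blockUnion (B :: π) := by
      rw [blockUnion_cons, sdiff_sdiff_left, sup_eq_union]
    rw [e, blockUnion_cons]
    constructor
    · rintro ⟨⟨h1, h2⟩, h3, h4, h5⟩
      have hd : Disjoint B (blockUnion π) := disjoint_sdiff.mono_right h3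
      refine ⟨union_subset h2 (h3.trans sdiff_subset), ⟨⟨h1, subset_union_left⟩, ?_⟩, h5⟩
      rwa [union_sdiff_cancel_left hd]
    · rintro ⟨h1, ⟨⟨h2, -⟩, h3⟩, h4⟩
      have hd : Disjoint B (blockUnion π) := by
        rw [h3.blockUnion_eq]
        exact disjoint_sdiff
      rw [union_sdiff_cancel_left hd] at h3
      exact ⟨⟨h2, subset_union_left.trans h1⟩,
        subset_sdiff.2 ⟨subset_union_right.trans h1, hd.symm⟩, h3, h4⟩

/-- The finite set of ordered partitions of `S` with `j` blocks. -/
def orderedPartitions : ℕ → Finset α → Finset (List (Finset α))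
  | 0, S => if S = ∅ then {[]} else ∅
  | j + 1, S => (S.powerset.erase ∅).biUnion fun B => (orderedPartitions j (S \ B)).image (B :: ·)

theorem mem_orderedPartitions {j : ℕ} {S : Finset α} {π : List (Finset α)} :
    π ∈ orderedPartitions j S ↔ IsOrderedPartition S π ∧ π.length = j := by
  induction j generalizing S π with
  | zero =>
    rw [orderedPartitions, List.length_eq_zero_iff]
    split_ifs with h
    · simp only [mem_singleton]
      exact ⟨fun h' => ⟨h' ▸ isOrderedPartition_nil.2 h, h'⟩, And.right⟩
    · simp only [notMem_empty, false_iff, not_and]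
      rintro h' rfl
      exact h (isOrderedPartition_nil.1 h')
  | succ j ih =>
    simp only [orderedPartitions, mem_biUnion, mem_image, mem_erase, mem_powerset, ih]
    constructor
    · rintro ⟨B, ⟨hB, hBS⟩, ρ, ⟨hρ, rfl⟩, rfl⟩
      exact ⟨isOrderedPartition_cons.2 ⟨⟨nonempty_iff_ne_empty.2 hB, hBS⟩, hρ⟩, rfl⟩
    · rintro ⟨h, hl⟩
      cases π with
      | nil => simp at hl
      | cons B ρ =>
        rw [isOrderedPartition_cons] at h
        exact ⟨B, ⟨nonempty_iff_ne_empty.1 h.1.1, h.1.2⟩, ρ, ⟨h.2, by simpa using hl⟩, rfl⟩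

theorem card_orderedPartitions (j : ℕ) (S : Finset α) :
    #(orderedPartitions j S) = surjCount #S j := by
  induction j generalizing S with
  | zero =>
    rw [orderedPartitions]
    split_ifs with h
    · simp [h]
    · obtain ⟨m, hm⟩ := Nat.exists_eq_succ_of_ne_zero (card_ne_zero.2 (nonempty_iff_ne_empty.2 h))
      simp [hm]
  | succ j ih =>
    rw [orderedPartitions, card_biUnion]
    · have h1 : ∀ B ∈ S.powerset.erase ∅,
          #((orderedPartitions j (S \ B)).image (B :: ·)) = surjCount (#S - #B) j := by
        intro B hB
        rw [card_image_of_injective _ List.cons_injective, ih,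
          card_sdiff_of_subset (mem_powerset.1 (mem_of_mem_erase hB))]
      rw [sum_congr rfl h1]
      have h2 := add_sum_erase S.powerset (fun B => surjCount (#S - #B) j) (empty_mem_powerset S)
      rw [sum_powerset_apply_card (fun m => surjCount (#S - m) j), ← sum_range_reflect] at h2
      have h3 : ∑ i ∈ range (#S + 1), (#S).choose (#S + 1 - 1 - i) •
          surjCount (#S - (#S + 1 - 1 - i)) j =
          ∑ i ∈ range (#S + 1), (#S).choose i * surjCount i j := by
        refine sum_congr rfl fun i hi => ?_
        have hi' : i ≤ #S := Nat.lt_succ_iff.1 (mem_range.1 hi)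
        rw [Nat.add_sub_cancel, Nat.choose_symm hi', Nat.sub_sub_self hi', smul_eq_mul]
      rw [h3, sum_range_succ, sum_choose_mul_surjCount_lt] at h2
      simp only [card_empty, Nat.sub_zero, Nat.choose_self, one_mul] at h2
      omega
    · intro B _ C _ hBC
      rw [Function.onFun, disjoint_left]
      intro π hB hC
      obtain ⟨ρ, _, rfl⟩ := mem_image.1 hB
      obtain ⟨ρ', _, h⟩ := mem_image.1 hC
      exact hBC (List.cons.inj h).1.symm

/-- Otherwise the counting formula would give zero for a set containing `π`. -/
theorem IsOrderedPartition.length_le {S : Finset α} {π : List (Finset α)}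
    (h : IsOrderedPartition S π) : π.length ≤ #S := by
  by_contra hlt
  have h1 := card_orderedPartitions π.length S
  rw [surjCount_eq_zero (not_le.1 hlt), card_eq_zero] at h1
  exact notMem_empty π (h1 ▸ mem_orderedPartitions.2 ⟨h, rfl⟩)

end OrderedPartitions

/-! ### Unions of half of the blocks -/

theorem sum_range_two_mul {M : Type*} [AddCommMonoid M] (f : ℕ → M) (N : ℕ) :
    ∑ m ∈ range (2 * N), f m = ∑ j ∈ range N, (f (2 * j) + f (2 * j + 1)) := by
  induction N with
  | zero => simp
  | succ N ih => rw [mul_add, mul_one, sum_range_succ, sum_range_succ, ih, sum_range_succ, add_assoc]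

theorem ncard_halfUnionPartitions (n k : ℕ) :
    (halfUnionPartitions n k).ncard = n.choose k * hCoeff k (n - k) := by
  -- Records the union of the first half, the number `m` of blocks, and both halves. The even bound
  -- on `m` lets the terms `2 * j` and `2 * j + 1` be paired; values of `m` that are too large
  -- contribute nothing.
  let T : Finset ((_ : Finset (Fin n)) × (_ : ℕ) × List (Finset (Fin n)) × List (Finset (Fin n))) :=
    (powersetCard k univ).sigma fun K => (range (2 * (n + 1))).sigma fun m =>
      orderedPartitions (m / 2) K ×ˢ orderedPartitions (m - m / 2) (univ \ K)
  have hT : #T = n.choose k * hCoeff k (n - k) := by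
    simp only [T, card_sigma, card_product, card_orderedPartitions, sum_range_two_mul]
    have h : ∀ K ∈ powersetCard k (univ : Finset (Fin n)),
        ∑ j ∈ range (n + 1), (surjCount #K (2 * j / 2) *
          surjCount #(univ \ K) (2 * j - 2 * j / 2) + surjCount #K ((2 * j + 1) / 2) *
          surjCount #(univ \ K) (2 * j + 1 - (2 * j + 1) / 2)) = hCoeff k (n - k) := by
      intro K hK
      obtain ⟨-, rfl⟩ := mem_powersetCard.1 hK
      rw [hCoeff_eq_sum_range (N := n + 1) (Nat.lt_succ_iff.2 (by simpa using card_le_univ K))]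
      refine sum_congr rfl fun j _ => ?_
      rw [card_sdiff_of_subset (subset_univ K), card_univ, Fintype.card_fin, partialSurjCount_eq,
        mul_add, show 2 * j / 2 = j by omega, show (2 * j + 1) / 2 = j by omega,
        show 2 * j - j = j by omega, show 2 * j + 1 - j = j + 1 by omega]
    rw [sum_congr rfl h, sum_const, card_powersetCard, card_univ, Fintype.card_fin, smul_eq_mul]
  rw [← hT, ← Set.ncard_coe_finset]
  refine Set.ncard_congr (fun π _ => ⟨blockUnion (π.take (π.length / 2)), π.length,
    π.take (π.length / 2), π.drop (π.length / 2)⟩) ?_ ?_ ?_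
  · rintro π ⟨h, hk⟩
    have hl := h.length_le
    have h' := h
    rw [← List.take_append_drop (π.length / 2) π, isOrderedPartition_append] at h'
    simp only [T, mem_coe, mem_sigma, mem_powersetCard, mem_range, mem_product,
      mem_orderedPartitions, List.length_take, List.length_drop]
    simp only [card_univ, Fintype.card_fin] at hl
    refine ⟨⟨subset_univ _, hk⟩, by omega, ⟨h'.2.1, by omega⟩, h'.2.2, trivial⟩
  · intro π ρ _ _ h
    simp only [Sigma.mk.injEq, heq_eq_eq, Prod.mk.injEq] at h
    rw [← List.take_append_drop (π.length / 2) π, h.2.2.1, h.2.2.2, List.take_append_drop]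
  · rintro ⟨K, m, π, ρ⟩ h
    simp only [T, mem_coe, mem_sigma, mem_powersetCard, mem_range, mem_product,
      mem_orderedPartitions] at h
    obtain ⟨⟨-, hK⟩, -, ⟨h1, h2⟩, h3, h4⟩ := h
    have hl : (π ++ ρ).length = m := by rw [List.length_append]; omega
    have ht : (π ++ ρ).take (m / 2) = π := by rw [← h2, List.take_left']; rfl
    have hd : (π ++ ρ).drop (m / 2) = ρ := by rw [← h2, List.drop_left']; rfl
    refine ⟨π ++ ρ, ⟨?_, ?_⟩, ?_⟩
    · rw [isOrderedPartition_append, h1.blockUnion_eq]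
      exact ⟨subset_univ _, h1, h3⟩
    · rw [hl, ht, h1.blockUnion_eq, hK]
    · simp only [hl, ht, hd, h1.blockUnion_eq]

/-! ### Coloured and pointed partitions -/

section Pairs

variable {α : Type*} [DecidableEq α]

theorem blockUnion_map_inter (b : Finset α) (π : List (Finset α)) :
    blockUnion (π.map (· ∩ b)) = blockUnion π ∩ b := by
  induction π with
  | nil => simp
  | cons B π ih => simp [ih, union_inter_distrib_right]

theorem blockUnion_map_sdiff (b : Finset α) (π : List (Finset α)) :
    blockUnion (π.map (· \ b)) = blockUnion π \ b := by
  induction π with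
  | nil => simp
  | cons B π ih => simp [ih, union_sdiff_distrib]

/-- Together with the next two lemmas: splitting every block into its black and white parts is
inverse to uniting blocks pairwise. -/
theorem zipWith_union_map (b : Finset α) (π : List (Finset α)) :
    List.zipWith (· ∪ ·) (π.map (· ∩ b)) (π.map (· \ b)) = π := by
  induction π with
  | nil => simp
  | cons B π ih => simp [ih, union_comm (B ∩ b), sdiff_union_inter]

theorem map_inter_zipWith {τ δ : List (Finset α)} {b : Finset α} (h : τ.length = δ.length)
    (h1 : blockUnion τ ⊆ b) (h2 : Disjoint b (blockUnion δ)) :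
    (List.zipWith (· ∪ ·) τ δ).map (· ∩ b) = τ := by
  induction τ generalizing δ with
  | nil => simp
  | cons C τ ih =>
    cases δ with
    | nil => simp at h
    | cons D δ =>
      rw [blockUnion_cons, union_subset_iff] at h1
      rw [blockUnion_cons, disjoint_union_right] at h2
      simp [ih (Nat.succ_injective h) h1.2 h2.2, union_inter_distrib_right,
        inter_eq_left.2 h1.1, disjoint_iff_inter_eq_empty.1 h2.1.symm]

theorem map_sdiff_zipWith {τ δ : List (Finset α)} {b : Finset α} (h : τ.length = δ.length)
    (h1 : blockUnion τ ⊆ b) (h2 : Disjoint b (blockUnion δ)) :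
    (List.zipWith (· ∪ ·) τ δ).map (· \ b) = δ := by
  induction τ generalizing δ with
  | nil => cases δ <;> simp_all
  | cons C τ ih =>
    cases δ with
    | nil => simp at h
    | cons D δ =>
      rw [blockUnion_cons, union_subset_iff] at h1
      rw [blockUnion_cons, disjoint_union_right] at h2
      simp [ih (Nat.succ_injective h) h1.2 h2.2, union_sdiff_distrib,
        sdiff_eq_empty_iff_subset.2 h1.1, sdiff_eq_self_of_disjoint h2.1.symm]

theorem IsOrderedPartition.map {S T : Finset α} {π : List (Finset α)} {f : Finset α → Finset α}
    (h : IsOrderedPartition S π) (hf : ∀ B ∈ π, f B ⊆ B ∧ (f B).Nonempty)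
    (hT : blockUnion (π.map f) = T) : IsOrderedPartition T (π.map f) := by
  refine ⟨?_, ?_, hT⟩
  · simpa using fun B hB => (hf B hB).2
  · exact List.pairwise_map.2 (h.2.1.imp_of_mem fun hB hC hd =>
      hd.mono (hf _ hB).1 (hf _ hC).1)

theorem IsOrderedPartition.zipWith_union {S T : Finset α} {τ δ : List (Finset α)}
    (h : τ.length = δ.length) (hτ : IsOrderedPartition S τ) (hδ : IsOrderedPartition T δ)
    (hd : Disjoint S T) : IsOrderedPartition (S ∪ T) (List.zipWith (· ∪ ·) τ δ) := by
  induction τ generalizing S T δ with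
  | nil =>
    cases δ with
    | nil =>
      rw [isOrderedPartition_nil] at hτ hδ
      simp [hτ, hδ, isOrderedPartition_nil]
    | cons => simp at h
  | cons C τ ih =>
    cases δ with
    | nil => simp at h
    | cons D δ =>
      rw [isOrderedPartition_cons] at hτ hδ
      rw [List.zipWith_cons_cons, isOrderedPartition_cons]
      refine ⟨⟨hτ.1.1.mono subset_union_left, union_subset_union hτ.1.2 hδ.1.2⟩, ?_⟩
      have e : (S ∪ T) \ (C ∪ D) = S \ C ∪ T \ D := by
        have h1 := hd.mono_left hτ.1.2
        have h2 := hd.mono_right hδ.1.2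
        rw [disjoint_left] at h1 h2
        ext x
        simp only [mem_sdiff, mem_union]
        have := @h1 x
        have := @h2 x
        tauto
      rw [e]
      exact ih (Nat.succ_injective h) hτ.2 hδ.2 (hd.mono sdiff_subset sdiff_subset)

theorem not_isMonochromatic_iff {b B : Finset α} :
    ¬ IsMonochromatic b B ↔ (B ∩ b).Nonempty ∧ (B \ b).Nonempty := by
  simp only [IsMonochromatic, not_or, not_forall, not_not, exists_prop, Finset.Nonempty, mem_inter,
    mem_sdiff, and_comm]

end Pairs

theorem ncard_colouredPartitions (n k : ℕ) :
    (colouredPartitions n k).ncard = n.choose k * hCoeff k (n - k) := by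
  -- Records the black set, the white set, the number of blocks, and the induced ordered partitions
  -- of the two sets.
  let T : Finset ((_ : Finset (Fin n)) × (_ : Finset (Fin n)) × (_ : ℕ) ×
      List (Finset (Fin n)) × List (Finset (Fin n))) :=
    (powersetCard k univ).sigma fun b => (univ \ b).powerset.sigma fun D =>
      (range (n + 1)).sigma fun j => orderedPartitions j b ×ˢ orderedPartitions j D
  have hT : #T = n.choose k * hCoeff k (n - k) := by
    simp only [T, card_sigma, card_product, card_orderedPartitions]
    have h : ∀ b ∈ powersetCard k (univ : Finset (Fin n)),
        ∑ D ∈ (univ \ b).powerset, ∑ j ∈ range (n + 1), surjCount #b j * surjCount #D j =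
          hCoeff k (n - k) := by
      intro b hb
      obtain ⟨-, rfl⟩ := mem_powersetCard.1 hb
      rw [hCoeff_eq_sum_range (N := n + 1) (Nat.lt_succ_iff.2 (by simpa using card_le_univ b)),
        sum_comm]
      refine sum_congr rfl fun j _ => ?_
      rw [← mul_sum, sum_powerset_apply_card (fun m => surjCount m j),
        card_sdiff_of_subset (subset_univ b), card_univ, Fintype.card_fin]
      simp only [smul_eq_mul, sum_choose_mul_surjCount]
    rw [sum_congr rfl h, sum_const, card_powersetCard, card_univ, Fintype.card_fin, smul_eq_mul]
  rw [← hT, ← Set.ncard_coe_finset]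
  refine Set.ncard_congr (fun t _ => ⟨t.2.2, t.1 \ t.2.2, t.2.1.length,
    t.2.1.map (· ∩ t.2.2), t.2.1.map (· \ t.2.2)⟩) ?_ ?_ ?_
  · rintro ⟨S, π, b⟩ ⟨h1, h2, h3, h4⟩
    simp only at h1 h2 h3 h4
    have hl := h1.length_le.trans (card_le_univ S)
    rw [Fintype.card_fin] at hl
    simp only [T, mem_coe, mem_sigma, mem_powersetCard, mem_range, mem_product, mem_powerset,
      mem_orderedPartitions, List.length_map]
    refine ⟨⟨subset_univ _, h3⟩, sdiff_subset_sdiff (subset_univ _) subset_rfl, by omega,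
      ⟨h1.map (fun B hB => ⟨inter_subset_left, (not_isMonochromatic_iff.1 (h4 B hB)).1⟩) ?_, trivial⟩,
      h1.map (fun B hB => ⟨sdiff_subset, (not_isMonochromatic_iff.1 (h4 B hB)).2⟩) ?_, trivial⟩
    · rw [blockUnion_map_inter, h1.blockUnion_eq, inter_eq_right.2 h2]
    · rw [blockUnion_map_sdiff, h1.blockUnion_eq]
  · rintro ⟨S, π, b⟩ ⟨S', π', b'⟩ ⟨h1, -⟩ ⟨h1', -⟩ h
    simp only [Sigma.mk.injEq, heq_eq_eq, Prod.mk.injEq] at h h1 h1'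
    obtain ⟨rfl, -, -, h2, h3⟩ := h
    have hπ : π = π' := by rw [← zipWith_union_map b π, h2, h3, zipWith_union_map]
    rw [← h1.blockUnion_eq, ← h1'.blockUnion_eq, hπ]
  · rintro ⟨b, D, j, τ, δ⟩ h
    simp only [T, mem_coe, mem_sigma, mem_powersetCard, mem_range, mem_product, mem_powerset,
      mem_orderedPartitions] at h
    obtain ⟨⟨-, h1⟩, h2, -, ⟨h3, h4⟩, h5, h6⟩ := h
    have hl : τ.length = δ.length := h4.trans h6.symm
    have hd : Disjoint b D := disjoint_sdiff.mono_right h2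
    have hi := map_inter_zipWith hl h3.blockUnion_eq.subset (h5.blockUnion_eq ▸ hd)
    have hs := map_sdiff_zipWith hl h3.blockUnion_eq.subset (h5.blockUnion_eq ▸ hd)
    refine ⟨(b ∪ D, List.zipWith (· ∪ ·) τ δ, b),
      ⟨h3.zipWith_union hl h5 hd, subset_union_left, h1, fun B hB => ?_⟩, ?_⟩
    · rw [not_isMonochromatic_iff]
      exact ⟨h3.1 _ (hi ▸ List.mem_map_of_mem hB), h5.1 _ (hs ▸ List.mem_map_of_mem hB)⟩
    · simp only [hi, hs, union_sdiff_cancel_left hd, List.length_zipWith, ← hl, min_self, h4]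

section Proper

variable {α : Type*} [DecidableEq α]

theorem weight_eq_card_blockUnion {π τ : List (Finset α)} (h : τ.Pairwise Disjoint) :
    weight (π, τ) = #(blockUnion τ) := by
  unfold weight
  induction τ with
  | nil => simp
  | cons C τ ih =>
    rw [List.pairwise_cons, ← disjoint_blockUnion_right] at h
    rw [blockUnion_cons, card_union_of_disjoint h.1, ← ih h.2, List.map_cons, List.sum_cons]

theorem blockUnion_subset_of_forall₂ {π τ : List (Finset α)}
    (h : List.Forall₂ (fun C B => C ⊆ B) τ π) : blockUnion τ ⊆ blockUnion π := by
  induction h with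
  | nil => simp
  | cons h _ ih => exact union_subset_union h ih

/-- As the blocks of `π` are disjoint, `τ` is recovered from the union of its blocks. Allowing any
`b` that agrees with this union on `blockUnion π` keeps `b` fixed in the induction. -/
theorem map_inter_eq_of_forall₂ {π τ : List (Finset α)} {b : Finset α}
    (h : List.Forall₂ (fun C B => C ⊆ B) τ π) (hπ : π.Pairwise Disjoint)
    (hb : ∀ x ∈ blockUnion π, x ∈ b ↔ x ∈ blockUnion τ) : π.map (· ∩ b) = τ := by
  induction h with
  | nil => simp
  | @cons C B τ π h h' ih =>
    rw [List.pairwise_cons, ← disjoint_blockUnion_right, disjoint_left] at hπ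
    have hs := blockUnion_subset_of_forall₂ h'
    simp only [blockUnion_cons, mem_union] at hb
    rw [List.map_cons, ih hπ.2 fun x hx => ?_]
    · congr 1
      ext x
      rw [mem_inter]
      have := hb x
      have := @hπ.1 x
      have := @hs x
      have := @h x
      tauto
    · have := hb x
      have := @hπ.1 x
      have := @h x
      tauto

theorem forall₂_map_inter {R : Finset α → Finset α → Prop} {b : Finset α}
    {π : List (Finset α)} (h : ∀ B ∈ π, R (B ∩ b) B) :
    List.Forall₂ R (π.map (· ∩ b)) π := by
  rw [List.forall₂_map_left_iff, List.forall₂_same]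
  exact h

end Proper

theorem ncard_properMultiPointed (n k : ℕ) :
    (properMultiPointed n k).ncard = (colouredPartitions n k).ncard := by
  refine Set.ncard_congr (fun φ _ => (blockUnion φ.1, φ.1, blockUnion φ.2)) ?_ ?_ ?_
  · rintro ⟨π, τ⟩ ⟨⟨S, h1, ⟨T, hT, h2⟩, h3⟩, h4, h5⟩
    simp only at h1 h2 h3 h4 h5
    have hm := map_inter_eq_of_forall₂ (b := blockUnion τ) h3 h1.2.1 fun x _ => Iff.rfl
    rw [weight_eq_card_blockUnion h2.2.1] at h5
    refine ⟨isOrderedPartition_blockUnion.2 ⟨h1.1, h1.2.1⟩, blockUnion_subset_of_forall₂ h3, h5,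
      fun B hB => ?_⟩
    have hB' : B ∩ blockUnion τ ∈ τ := by
      have := List.mem_map_of_mem (f := (· ∩ blockUnion τ)) hB
      rwa [hm] at this
    rw [not_isMonochromatic_iff]
    refine ⟨h2.1 _ hB', ?_⟩
    simp only [IsProper] at h4
    rw [← hm, List.forall₂_map_left_iff, List.forall₂_same] at h4
    have := h4 B hB
    rw [sdiff_nonempty]
    exact fun h => this.2 (subset_inter subset_rfl h)
  · rintro ⟨π, τ⟩ ⟨π', τ'⟩ ⟨⟨S, h1, -, h3⟩, -⟩ ⟨⟨S', h1', -, h3'⟩, -⟩ h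
    simp only [Prod.mk.injEq] at h h1 h1' h3 h3'
    obtain ⟨-, rfl, h⟩ := h
    rw [← map_inter_eq_of_forall₂ h3 h1.2.1 fun x _ => Iff.rfl,
      ← map_inter_eq_of_forall₂ h3' h1.2.1 fun x _ => Iff.rfl, h]
  · rintro ⟨S, π, b⟩ ⟨h1, h2, h3, h4⟩
    simp only at h1 h2 h3 h4
    have hu : blockUnion (π.map (· ∩ b)) = b := by
      rw [blockUnion_map_inter, h1.blockUnion_eq, inter_eq_right.2 h2]
    have hp : IsOrderedPartition b (π.map (· ∩ b)) :=
      h1.map (fun B hB => ⟨inter_subset_left, (not_isMonochromatic_iff.1 (h4 B hB)).1⟩) hu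
    refine ⟨(π, π.map (· ∩ b)), ⟨⟨S, h1, ⟨b, h2, hp⟩, forall₂_map_inter fun B _ =>
      inter_subset_left⟩, forall₂_map_inter fun B hB => ?_, ?_⟩, ?_⟩
    · refine ⟨inter_subset_left, fun h => ?_⟩
      obtain ⟨x, hx⟩ := (not_isMonochromatic_iff.1 (h4 B hB)).2
      rw [mem_sdiff] at hx
      exact hx.2 (mem_inter.1 (h hx.1)).2
    · rw [weight_eq_card_blockUnion hp.2.1, hu, h3]
    · simp only [hu, h1.blockUnion_eq]

/-! ### Faces of the antiprism triangulation of a simplex -/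

section Faces

variable {α : Type*}

/-- The faces of the antiprism triangulation, as sets of pairs. -/
def IsAntiprismFace (F : Finset (Finset α × α)) : Prop :=
  (∀ p ∈ F, p.2 ∈ p.1) ∧ ∀ p ∈ F, ∀ q ∈ F,
    p.1 = q.1 ∨ (p.1 ⊂ q.1 ∧ q.2 ∉ p.1) ∨ (q.1 ⊂ p.1 ∧ p.2 ∉ q.1)

open Classical in
/-- The faces of the antiprism triangulation of the simplex on `S`. -/
noncomputable def antiprismFaces (S : Finset α) : Finset (Finset (Finset α × α)) :=
  {F ∈ (S.powerset ×ˢ S).powerset | IsAntiprismFace F}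

theorem mem_antiprismFaces {S : Finset α} {F : Finset (Finset α × α)} :
    F ∈ antiprismFaces S ↔ (∀ p ∈ F, p.1 ⊆ S) ∧ IsAntiprismFace F := by
  simp only [antiprismFaces, mem_filter, mem_powerset, subset_iff (s₁ := F), mem_product]
  exact ⟨fun h => ⟨fun p hp => (h.1 hp).1, h.2⟩,
    fun h => ⟨fun p hp => ⟨h.1 p hp, h.1 p hp (h.2.1 p hp)⟩, h.2⟩⟩

/-- The points of a face are distinct: of two different sets the larger has its point outside the
smaller, whose own point lies inside. -/
theorem card_le_of_mem_antiprismFaces {S : Finset α} {F : Finset (Finset α × α)}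
    (hF : F ∈ antiprismFaces S) : #F ≤ #S := by
  rw [mem_antiprismFaces] at hF
  obtain ⟨h1, h2, h3⟩ := hF
  refine card_le_card_of_injOn Prod.snd (fun p hp => h1 p hp (h2 p hp)) fun p hp q hq h => ?_
  have hp' := h2 p hp
  have hq' := h2 q hq
  rcases h3 p hp q hq with h4 | h4 | h4
  · exact Prod.ext h4 h
  · exact absurd (h ▸ hp') h4.2
  · exact absurd (h ▸ hq') h4.2

variable [DecidableEq α]

/-- The largest set occurring in a face. -/
def topSet (F : Finset (Finset α × α)) : Finset α := F.biUnion Prod.fst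

/-- The points of the largest set occurring in a face. -/
def topPoints (F : Finset (Finset α × α)) : Finset α :=
  (F.filter fun p => p.1 = topSet F).image Prod.snd

/-- The pairs whose first entry is not the largest set occurring in a face. -/
def lowerFace (F : Finset (Finset α × α)) : Finset (Finset α × α) :=
  F.filter fun p => p.1 ≠ topSet F

/-- Adds pointed copies of the set `R ∪ C` to a face. -/
def addTop (R C : Finset α) (F : Finset (Finset α × α)) : Finset (Finset α × α) :=
  F ∪ C.image fun v => (R ∪ C, v)

theorem mem_addTop {R C : Finset α} {F : Finset (Finset α × α)} {p : Finset α × α} :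
    p ∈ addTop R C F ↔ p ∈ F ∨ (p.1 = R ∪ C ∧ p.2 ∈ C) := by
  rcases p with ⟨A, x⟩
  simp only [addTop, mem_union, mem_image, Prod.mk.injEq]
  constructor
  · rintro (h | ⟨v, hv, rfl, rfl⟩)
    exacts [.inl h, .inr ⟨rfl, hv⟩]
  · rintro (h | ⟨rfl, h⟩)
    exacts [.inl h, .inr ⟨x, h, rfl, rfl⟩]

section addTop

variable {R C : Finset α} {F : Finset (Finset α × α)}

theorem ne_union_of_mem (hRC : Disjoint R C) (hC : C.Nonempty)
    (hF : F ∈ antiprismFaces R) {p : Finset α × α} (hp : p ∈ F) : p.1 ≠ R ∪ C := by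
  intro h
  obtain ⟨x, hx⟩ := hC
  have := (mem_antiprismFaces.1 hF).1 p hp (h ▸ mem_union_right R hx)
  exact disjoint_left.1 hRC this hx

theorem topSet_addTop (hC : C.Nonempty) (hF : F ∈ antiprismFaces R) :
    topSet (addTop R C F) = R ∪ C := by
  ext x
  simp only [topSet, mem_biUnion, mem_addTop]
  constructor
  · rintro ⟨p, hp | hp, hx⟩
    · exact mem_union_left _ ((mem_antiprismFaces.1 hF).1 p hp hx)
    · exact hp.1 ▸ hx
  · intro hx
    obtain ⟨v, hv⟩ := hC
    exact ⟨(R ∪ C, v), .inr ⟨rfl, hv⟩, hx⟩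

theorem topPoints_addTop (hRC : Disjoint R C) (hC : C.Nonempty)
    (hF : F ∈ antiprismFaces R) :
    topPoints (addTop R C F) = C := by
  ext x
  simp only [topPoints, topSet_addTop hC hF, mem_image, mem_filter, mem_addTop]
  constructor
  · rintro ⟨p, ⟨hp | hp, hp'⟩, rfl⟩
    · exact absurd hp' (ne_union_of_mem hRC hC hF hp)
    · exact hp.2
  · exact fun hx => ⟨(R ∪ C, x), ⟨.inr ⟨rfl, hx⟩, rfl⟩, rfl⟩

theorem lowerFace_addTop (hRC : Disjoint R C) (hC : C.Nonempty)
    (hF : F ∈ antiprismFaces R) :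
    lowerFace (addTop R C F) = F := by
  ext p
  simp only [lowerFace, topSet_addTop hC hF, mem_filter, mem_addTop]
  constructor
  · rintro ⟨hp | hp, hp'⟩
    · exact hp
    · exact absurd hp.1 hp'
  · exact fun hp => ⟨.inl hp, ne_union_of_mem hRC hC hF hp⟩

theorem card_addTop (hRC : Disjoint R C) (hC : C.Nonempty)
    (hF : F ∈ antiprismFaces R) :
    #(addTop R C F) = #C + #F := by
  rw [addTop, card_union_of_disjoint, card_image_of_injective _ (Prod.mk_right_injective _),
    add_comm]
  rw [disjoint_left]
  intro p hp hp'
  obtain ⟨v, _, rfl⟩ := mem_image.1 hp'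
  exact ne_union_of_mem hRC hC hF hp rfl

theorem isAntiprismFace_addTop (hRC : Disjoint R C) (hC : C.Nonempty)
    (hF : F ∈ antiprismFaces R) :
    IsAntiprismFace (addTop R C F) := by
  have hF' := mem_antiprismFaces.1 hF
  have key : ∀ p ∈ F, ∀ q : Finset α × α, q.1 = R ∪ C ∧ q.2 ∈ C → p.1 ⊂ q.1 ∧ q.2 ∉ p.1 := by
    intro p hp q hq
    rw [hq.1]
    exact ⟨((hF'.1 p hp).trans subset_union_left).ssubset_of_ne (ne_union_of_mem hRC hC hF hp),
      fun h => disjoint_left.1 hRC (hF'.1 p hp h) hq.2⟩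
  constructor
  · intro p hp
    rcases mem_addTop.1 hp with hp | hp
    · exact hF'.2.1 p hp
    · exact hp.1 ▸ mem_union_right _ hp.2
  · intro p hp q hq
    rcases mem_addTop.1 hp with hp | hp <;> rcases mem_addTop.1 hq with hq | hq
    · exact hF'.2.2 p hp q hq
    · exact .inr (.inl (key p hp q hq))
    · exact .inr (.inr (key q hq p hp))
    · exact .inl (hp.1.trans hq.1.symm)

end addTop

section Top

variable {S : Finset α} {F : Finset (Finset α × α)}

theorem topSet_subset (hF : F ∈ antiprismFaces S) : topSet F ⊆ S :=
  biUnion_subset.2 (mem_antiprismFaces.1 hF).1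

theorem fst_subset_topSet {p : Finset α × α} (hp : p ∈ F) : p.1 ⊆ topSet F :=
  subset_biUnion_of_mem Prod.fst hp

theorem mem_topPoints {x : α} : x ∈ topPoints F ↔ (topSet F, x) ∈ F := by
  simp only [topPoints, mem_image, mem_filter]
  constructor
  · rintro ⟨p, ⟨hp, hp'⟩, rfl⟩
    rwa [← hp']
  · exact fun h => ⟨_, ⟨h, rfl⟩, rfl⟩

/-- The sets in a face form a chain, so their union is the one of largest cardinality. -/
theorem topPoints_nonempty (hF : F ∈ antiprismFaces S) (hne : F.Nonempty) :
    (topPoints F).Nonempty := by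
  obtain ⟨p, hp, hmax⟩ := exists_max_image F (fun p => #p.1) hne
  have h : topSet F = p.1 := by
    refine subset_antisymm (biUnion_subset.2 fun q hq => ?_) (fst_subset_topSet hp)
    rcases (mem_antiprismFaces.1 hF).2.2 p hp q hq with h | h | h
    · exact h.ge
    · exact absurd (card_lt_card h.1) (hmax q hq).not_gt
    · exact h.1.subset
  exact ⟨p.2, mem_topPoints.2 (h ▸ hp)⟩

theorem topPoints_subset (hF : F ∈ antiprismFaces S) : topPoints F ⊆ topSet F :=
  fun _ hx => (mem_antiprismFaces.1 hF).2.1 _ (mem_topPoints.1 hx)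

theorem lowerFace_mem (hF : F ∈ antiprismFaces S) :
    lowerFace F ∈ antiprismFaces (topSet F \ topPoints F) := by
  have hF' := mem_antiprismFaces.1 hF
  refine mem_antiprismFaces.2 ⟨fun p hp => ?_, fun p hp => hF'.2.1 p (mem_filter.1 hp).1,
    fun p hp q hq => hF'.2.2 p (mem_filter.1 hp).1 q (mem_filter.1 hq).1⟩
  obtain ⟨hp, hp'⟩ := mem_filter.1 hp
  refine subset_sdiff.2 ⟨fst_subset_topSet hp, disjoint_right.2 fun x hx => ?_⟩
  rw [mem_topPoints] at hx
  rcases hF'.2.2 p hp _ hx with h | h | h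
  · exact absurd h hp'
  · exact h.2
  · exact absurd (fst_subset_topSet hp) h.1.2

theorem addTop_lowerFace (hF : F ∈ antiprismFaces S) :
    addTop (topSet F \ topPoints F) (topPoints F) (lowerFace F) = F := by
  ext p
  rw [mem_addTop, sdiff_union_of_subset (topPoints_subset hF), lowerFace, mem_filter, mem_topPoints]
  by_cases h : p.1 = topSet F
  · simp [← h]
  · simp [h]

end Top

/-- The generating function of the faces of the antiprism triangulation of the simplex on `S`. -/
noncomputable def faceSum {A : Type*} [CommRing A] (u v : A) (S : Finset α) : A :=
  ∑ F ∈ antiprismFaces S, u ^ #F * v ^ (#S - #F)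

/-- The empty face gives `v ^ #S`. A nonempty face is a set `R`, a nonempty set `C` of top points
outside `R`, and a face over `R`. Summing over `C` gives `(u + v) ^ m - v ^ m = 1 - v ^ m` with `m =
#S - #R`. -/
theorem faceSum_eq {A : Type*} [CommRing A] {u v : A} (huv : u + v = 1) (S : Finset α) :
    faceSum u v S = v ^ #S + ∑ R ∈ S.powerset, (1 - v ^ (#S - #R)) * faceSum u v R := by
  have h1 : ∑ F ∈ (antiprismFaces S).erase ∅, u ^ #F * v ^ (#S - #F) =
      ∑ R ∈ S.powerset, ∑ C ∈ (S \ R).powerset.erase ∅, ∑ F ∈ antiprismFaces R,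
        (u ^ #C * v ^ (#(S \ R) - #C)) * (u ^ #F * v ^ (#R - #F)) := by
    simp only [sum_sigma']
    refine sum_nbij' (fun F => ⟨topSet F \ topPoints F, topPoints F, lowerFace F⟩)
      (fun t => addTop t.1 t.2.1 t.2.2) ?_ ?_ ?_ ?_ ?_
    · intro F hF
      obtain ⟨hne, hF⟩ := mem_erase.1 hF
      simp only [mem_sigma, mem_powerset, mem_erase]
      refine ⟨sdiff_subset.trans (topSet_subset hF), ⟨?_, ?_⟩, lowerFace_mem hF⟩
      · exact nonempty_iff_ne_empty.1 (topPoints_nonempty hF (nonempty_iff_ne_empty.2 hne))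
      · exact subset_sdiff.2 ⟨(topPoints_subset hF).trans (topSet_subset hF), disjoint_sdiff⟩
    · rintro ⟨R, C, F⟩ h
      simp only [mem_sigma, mem_powerset, mem_erase, ← nonempty_iff_ne_empty, subset_sdiff] at h
      obtain ⟨hR, ⟨hC, hCS, hRC⟩, hF⟩ := h
      obtain ⟨v, hv⟩ := id hC
      refine mem_erase.2 ⟨ne_empty_of_mem (mem_addTop.2 (.inr (a := (R ∪ C, v) ∈ F) ⟨rfl, hv⟩)),
        mem_antiprismFaces.2 ⟨fun p hp => ?_, isAntiprismFace_addTop hRC.symm hC hF⟩⟩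
      rcases mem_addTop.1 hp with hp | hp
      · exact ((mem_antiprismFaces.1 hF).1 p hp).trans hR
      · exact hp.1 ▸ union_subset hR hCS
    · intro F hF
      exact addTop_lowerFace (mem_of_mem_erase hF)
    · rintro ⟨R, C, F⟩ h
      simp only [mem_sigma, mem_powerset, mem_erase, ← nonempty_iff_ne_empty, subset_sdiff] at h
      obtain ⟨hR, ⟨hC, hCS, hRC⟩, hF⟩ := h
      simp only [topSet_addTop hC hF, topPoints_addTop hRC.symm hC hF,
        lowerFace_addTop hRC.symm hC hF, union_sdiff_cancel_right hRC.symm]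
    · intro F hF
      obtain ⟨hne, hF⟩ := mem_erase.1 hF
      have hC := topPoints_nonempty hF (nonempty_iff_ne_empty.2 hne)
      have hl := lowerFace_mem hF
      have hcard : #F = #(topPoints F) + #(lowerFace F) := by
        conv_lhs => rw [← addTop_lowerFace hF]
        exact card_addTop disjoint_sdiff.symm hC hl
      have hR : topSet F \ topPoints F ⊆ S := sdiff_subset.trans (topSet_subset hF)
      have hC' : topPoints F ⊆ S \ (topSet F \ topPoints F) :=
        subset_sdiff.2 ⟨(topPoints_subset hF).trans (topSet_subset hF), disjoint_sdiff⟩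
      -- These bounds ensure that the truncated subtractions in the exponents add up.
      have h1 := card_le_of_mem_antiprismFaces hl
      have h2 := card_le_card hC'
      have h3 := card_le_card hR
      have h4 := card_sdiff_of_subset hR
      simp only
      rw [mul_mul_mul_comm, ← pow_add, ← pow_add, ← hcard]
      congr 2
      omega
  have h2 : ∅ ∈ antiprismFaces S := mem_antiprismFaces.2 ⟨by simp, by simp, by simp⟩
  rw [faceSum, ← add_sum_erase _ _ h2, h1]
  congr 1
  · simp
  · refine sum_congr rfl fun R hR => ?_
    simp only [← mul_sum, ← sum_mul]
    congr 1
    have h3 := add_sum_erase _ (fun C => u ^ #C * v ^ (#(S \ R) - #C)) (empty_mem_powerset (S \ R))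
    rw [sum_pow_mul_eq_add_pow, huv, one_pow, card_sdiff_of_subset (mem_powerset.1 hR)] at h3
    simp only [card_empty, pow_zero, one_mul, Nat.sub_zero] at h3
    rw [card_sdiff_of_subset (mem_powerset.1 hR), eq_sub_iff_add_eq', h3]

end Faces

/-! ### Translation from the triangulation to sets of pairs -/

/-- A pointed face as a pair. -/
def toPair {V : Type*} (K : AbstractSimplicialComplex V) : PointedFace K ↪ Finset V × V :=
  ⟨fun p => p.1, Subtype.val_injective⟩

open Classical in
theorem mem_allFaces_antiprismTriangulation {n : ℕ} {F : Finset (PointedFace (simplex n))} :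
    F ∈ allFaces (antiprismTriangulation (simplex n)) ↔
      F.map (toPair (simplex n)) ∈ antiprismFaces (univ : Finset (Fin n)) := by
  have h1 : F ∈ allFaces (antiprismTriangulation (simplex n)) ↔
      (antiprismGraph (simplex n)).IsClique (F : Set (PointedFace (simplex n))) := by
    unfold allFaces
    rw [mem_filter]
    simp only [mem_univ, true_and]
    constructor
    · rintro (rfl | h)
      · simp
      · exact h.2
    · intro h
      exact F.eq_empty_or_nonempty.imp_right fun hne => ⟨hne, h⟩
  rw [h1, mem_antiprismFaces]
  simp only [IsAntiprismFace, forall_mem_map, subset_univ,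
    implies_true, true_and]
  constructor
  · refine fun h => ⟨fun p _ => p.2.2, fun p hp q hq => ?_⟩
    by_cases hpq : p = q
    · exact .inl (by rw [hpq])
    · rcases (h (mem_coe.2 hp) (mem_coe.2 hq) hpq).2 with h | h | h
      exacts [.inl h, .inr (.inl ⟨h.1, h.2.2⟩), .inr (.inr ⟨h.1, h.2.2⟩)]
  · intro h p hp q hq hpq
    refine ⟨hpq, ?_⟩
    rcases h.2 p hp q hq with h | h | h
    exacts [.inl h, .inr (.inl ⟨h.1, q.2.2, h.2⟩), .inr (.inr ⟨h.1, p.2.2, h.2⟩)]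

theorem rank_antiprismTriangulation_simplex (n : ℕ) :
    rank (antiprismTriangulation (simplex n)) = n := by
  refine le_antisymm (Finset.sup_le fun F hF => ?_) ?_
  · have := card_le_of_mem_antiprismFaces (mem_allFaces_antiprismTriangulation.1 hF)
    rwa [card_map, card_univ, Fintype.card_fin] at this
  -- The `n` pointed copies of the full vertex set form a face of maximal size.
  · let f : Fin n ↪ PointedFace (simplex n) :=
      ⟨fun v => ⟨(univ, v), ⟨v, mem_univ v⟩, mem_univ v⟩, fun v w h =>
        (Prod.ext_iff.1 (Subtype.ext_iff.1 h)).2⟩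
    have hf : univ.map f ∈ allFaces (antiprismTriangulation (simplex n)) := by
      rw [mem_allFaces_antiprismTriangulation, mem_antiprismFaces]
      simp only [IsAntiprismFace, forall_mem_map, subset_univ, implies_true, true_and]
      exact ⟨fun v _ => mem_univ v, fun _ _ _ _ => .inl rfl⟩
    have := le_sup (f := card) hf
    rwa [card_map, card_univ, Fintype.card_fin] at this

theorem hA_eq_faceSum (n : ℕ) :
    hA n = faceSum Polynomial.X (1 - Polynomial.X) (univ : Finset (Fin n)) := by
  rw [hA, hPolynomial, rank_antiprismTriangulation_simplex, faceSum, card_univ, Fintype.card_fin]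
  refine sum_bij (fun F _ => F.map (toPair (simplex n))) ?_ ?_ ?_ ?_
  · exact fun F hF => mem_allFaces_antiprismTriangulation.1 hF
  · exact fun F _ G _ h => map_injective _ h
  · intro G hG
    have hG' := mem_antiprismFaces.1 hG
    let p : Finset (Fin n) × Fin n → Prop := fun p => p.1 ∈ simplex n ∧ p.2 ∈ p.1
    classical
    let H : Finset (PointedFace (simplex n)) := G.subtype p
    have h : H.map (toPair (simplex n)) = G :=
      subtype_map_of_mem fun q hq => ⟨⟨q.2, hG'.2.1 q hq⟩, hG'.2.1 q hq⟩
    exact ⟨H, mem_allFaces_antiprismTriangulation.2 (h.symm ▸ hG), h⟩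
  · intro F _
    rw [card_map]

/-- The term `R = S` of `faceSum_eq` has coefficient zero, so the recursion determines its solution.
-/
theorem faceSum_eq_of_card_eq {α A : Type*} [DecidableEq α] [CommRing A] {u v : A}
    (huv : u + v = 1) {S : Finset α} {f : ℕ → A}
    (hf : ∀ n, f n = v ^ n + ∑ r ∈ range n, n.choose r • ((1 - v ^ (n - r)) * f r)) :
    faceSum u v S = f #S := by
  induction S using Finset.strongInduction with
  | H S ih =>
    rw [faceSum_eq huv, hf, ← add_sum_erase _ _ (mem_powerset_self S)]
    simp only [Nat.sub_self, pow_zero, sub_self, zero_mul, zero_add]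
    congr 1
    have h : ∀ R ∈ S.powerset.erase S, (1 - v ^ (#S - #R)) * faceSum u v R =
        (1 - v ^ (#S - #R)) * f #R := by
      intro R hR
      rw [mem_erase, mem_powerset] at hR
      rw [ih R (hR.2.ssubset_of_ne hR.1)]
    rw [sum_congr rfl h]
    have h1 := add_sum_erase _ (fun R => (1 - v ^ (#S - #R)) * f #R) (mem_powerset_self S)
    rw [sum_powerset_apply_card (fun m => (1 - v ^ (#S - m)) * f m), sum_range_succ] at h1
    simpa using h1

/-! ### Exponential generating functions -/

section EGF

open PowerSeries

variable {A : Type*} [CommRing A] [Algebra ℚ A]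

/-- The exponential generating function of a sequence. -/
noncomputable def egf (f : ℕ → A) : PowerSeries A :=
  PowerSeries.mk fun n => algebraMap ℚ A (1 / n.factorial) * f n

theorem coeff_egf (f : ℕ → A) (n : ℕ) :
    coeff n (egf f) = algebraMap ℚ A (1 / n.factorial) * f n := coeff_mk _ _

theorem egf_injective : Function.Injective (egf (A := A)) := by
  intro f g h
  ext n
  have h1 := congrArg (fun F => algebraMap ℚ A n.factorial * coeff n F) h
  have h2 : algebraMap ℚ A n.factorial * algebraMap ℚ A (1 / n.factorial) = 1 := by
    rw [← map_mul, mul_one_div_cancel (Nat.cast_ne_zero.2 n.factorial_ne_zero), map_one]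
  simpa only [coeff_egf, ← mul_assoc, h2, one_mul] using h1

theorem egf_add (f g : ℕ → A) : egf (fun n => f n + g n) = egf f + egf g := by
  ext n
  simp only [coeff_egf, map_add, mul_add]

theorem egf_sub (f g : ℕ → A) : egf (fun n => f n - g n) = egf f - egf g := by
  ext n
  simp only [coeff_egf, map_sub, mul_sub]

theorem egf_sum {ι : Type*} (s : Finset ι) (f : ι → ℕ → A) :
    egf (fun n => ∑ i ∈ s, f i n) = ∑ i ∈ s, egf (f i) := by
  ext n
  simp only [coeff_egf, map_sum, mul_sum]

theorem egf_mul (f g : ℕ → A) :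
    egf f * egf g = egf fun n => ∑ r ∈ range (n + 1), n.choose r • (f r * g (n - r)) := by
  ext n
  rw [coeff_mul, Nat.sum_antidiagonal_eq_sum_range_succ_mk, coeff_egf, mul_sum]
  refine sum_congr rfl fun r hr => ?_
  have hr' : r ≤ n := Nat.lt_succ_iff.1 (mem_range.1 hr)
  have h : (1 / r.factorial : ℚ) * (1 / (n - r).factorial) = 1 / n.factorial * n.choose r := by
    rw [Nat.cast_choose ℚ hr']
    have := Nat.factorial_ne_zero n
    field_simp
  simp only [coeff_egf]
  rw [mul_mul_mul_comm, ← map_mul, h, map_mul, map_natCast, nsmul_eq_mul, mul_assoc]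

theorem rescale_exp_eq_egf (a : A) : rescale a (exp A) = egf fun n => a ^ n := by
  ext n
  rw [coeff_rescale, coeff_exp, coeff_egf, mul_comm]

theorem exp_eq_egf : exp A = egf fun _ => 1 := by
  ext n
  rw [coeff_exp, coeff_egf, mul_one]

theorem exp_sub_one_pow (j : ℕ) : (exp A - 1) ^ j = egf fun n => (surjCount n j : A) := by
  induction j with
  | zero =>
    ext n
    rw [pow_zero, coeff_egf, coeff_one]
    cases n <;> simp
  | succ j ih =>
    have h : egf (fun n => (surjCount n j : A)) * egf (fun _ => 1) =
        egf (fun n => (surjCount n j : A)) + egf fun n => (surjCount n (j + 1) : A) := by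
      rw [egf_mul, ← egf_add]
      congr 1
      ext n
      rw [← Nat.cast_add, ← partialSurjCount_eq, ← sum_choose_mul_surjCount]
      simp
    rw [pow_succ, ih, mul_sub, exp_eq_egf, h, mul_one, add_sub_cancel_left]

theorem exp_mul_exp_sub_one_pow (j : ℕ) :
    exp A * (exp A - 1) ^ j = egf fun n => (partialSurjCount n j : A) := by
  have h : exp A * (exp A - 1) ^ j = (exp A - 1) ^ j + (exp A - 1) ^ (j + 1) := by ring
  rw [h, exp_sub_one_pow, exp_sub_one_pow, ← egf_add]
  simp only [partialSurjCount_eq, Nat.cast_add]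

theorem rescale_exp_sub_one_pow (a : A) (j : ℕ) :
    (rescale a (exp A) - 1) ^ j = egf fun n => a ^ n * (surjCount n j : A) := by
  have h : (rescale a (exp A) - 1) ^ j = rescale a ((exp A - 1) ^ j) := by simp
  rw [h, exp_sub_one_pow]
  ext n
  rw [coeff_rescale, coeff_egf, coeff_egf, mul_left_comm]

/-- The value at `a` of the polynomial with coefficients `n.choose k * hCoeff k (n - k)`. -/
def hValue (a : A) (n : ℕ) : A :=
  ∑ k ∈ range (n + 1), n.choose k • (hCoeff k (n - k) • a ^ k)

theorem egf_term (a : A) (j : ℕ) :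
    exp A * ((rescale a (exp A) - 1) * (exp A - 1)) ^ j =
      egf fun n => ∑ k ∈ range (n + 1), n.choose k •
        (a ^ k * (surjCount k j : A) * (partialSurjCount (n - k) j : A)) := by
  rw [mul_pow, mul_left_comm, exp_mul_exp_sub_one_pow, rescale_exp_sub_one_pow, egf_mul]

/-- A finite truncation replaces the infinite geometric series, since `surjCount k j` vanishes for
`j > k`. -/
theorem coeff_egf_hValue (a : A) {n N : ℕ} (h : n < N) :
    coeff n (egf (hValue a)) =
      coeff n (∑ j ∈ range N, exp A * ((rescale a (exp A) - 1) * (exp A - 1)) ^ j) := by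
  simp only [egf_term, ← egf_sum]
  rw [coeff_egf, coeff_egf, hValue]
  congr 1
  rw [sum_comm]
  refine sum_congr rfl fun k hk => ?_
  rw [← smul_sum, hCoeff_eq_sum_range (N := N) (by have := mem_range.1 hk; omega), sum_smul]
  congr 1
  refine sum_congr rfl fun j _ => ?_
  rw [nsmul_eq_mul]
  push_cast
  ring

theorem egf_hValue_mul (a : A) :
    egf (hValue a) * (1 - (rescale a (exp A) - 1) * (exp A - 1)) = exp A := by
  set Y := (rescale a (exp A) - 1) * (exp A - 1) with hY
  ext n
  have h1 : coeff n (egf (hValue a) * (1 - Y)) =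
      coeff n ((∑ j ∈ range (n + 1), exp A * Y ^ j) * (1 - Y)) := by
    rw [coeff_mul, coeff_mul]
    refine sum_congr rfl fun p hp => ?_
    rw [coeff_egf_hValue a (N := n + 1)]
    have := mem_antidiagonal.1 hp
    omega
  have h2 : (∑ j ∈ range (n + 1), exp A * Y ^ j) * (1 - Y) = exp A - exp A * Y ^ (n + 1) := by
    rw [← mul_sum, mul_assoc, mul_comm (∑ i ∈ _, _), mul_neg_geom_sum, mul_sub, mul_one]
  rw [h1, h2, map_sub, hY, egf_term, coeff_egf, sum_eq_zero, mul_zero, sub_zero]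
  intro k hk
  rw [surjCount_eq_zero (mem_range.1 hk)]
  simp

theorem egf_hValue_eq (a : A) :
    egf (hValue a) = rescale (1 - a) (exp A) +
      egf (hValue a) * (exp A - rescale (1 - a) (exp A)) := by
  have h1 : rescale a (exp A) * rescale (1 - a) (exp A) = exp A := by
    rw [exp_mul_exp_eq_exp_add, add_sub_cancel, rescale_one, RingHom.id_apply]
  have h2 : rescale (-a) (exp A) * rescale a (exp A) = 1 := by
    rw [exp_mul_exp_eq_exp_add, neg_add_cancel, rescale_zero_apply]
    simp
  have h3 := egf_hValue_mul a
  set P := egf (hValue a)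
  set E := rescale a (exp A)
  set V := rescale (1 - a) (exp A)
  set E' := rescale (-a) (exp A)
  set U := exp A
  -- In essence `h3` is divided by `E`, whose inverse is `E'`, and `V = E' * U`.
  linear_combination E' * h3 + (V * (1 - P) - P + P * U) * h2 + (P * E' - E') * h1

theorem hValue_rec (a : A) (n : ℕ) :
    hValue a n = (1 - a) ^ n +
      ∑ r ∈ range n, n.choose r • ((1 - (1 - a) ^ (n - r)) * hValue a r) := by
  have h := egf_hValue_eq a
  rw [rescale_exp_eq_egf, exp_eq_egf, ← egf_sub, egf_mul, ← egf_add] at h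
  have h' := congrFun (egf_injective h) n
  rw [sum_range_succ] at h'
  simpa [mul_comm] using h'

end EGF

/-! ### Coefficients of the `h`-polynomial -/

open Polynomial in
theorem coeff_hA (n k : ℕ) : (hA n).coeff k = n.choose k * hCoeff k (n - k) := by
  -- Rational coefficients are needed to divide by factorials; taking `a = X` makes `hValue` the
  -- polynomial itself.
  have hmap : (hA n).map (Int.castRingHom ℚ) = hValue (X : ℚ[X]) n := by
    have h := faceSum_eq_of_card_eq (u := (X : ℚ[X])) (v := 1 - X) (by ring)
      (S := (univ : Finset (Fin n))) (hValue_rec X)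
    rw [card_univ, Fintype.card_fin] at h
    rw [← h, hA_eq_faceSum, faceSum, faceSum, Polynomial.map_sum]
    simp
  have h := congrArg (fun p => coeff p k) hmap
  simp only [coeff_map, hValue, finsetSum_coeff, coeff_smul, coeff_X_pow, eq_intCast] at h
  have h2 : ((hA n).coeff k : ℚ) = ((n.choose k * hCoeff k (n - k) : ℤ) : ℚ) := by
    rw [h]
    simp only [smul_ite, smul_zero]
    rw [sum_ite_eq]
    split_ifs with hk
    · simp
    · rw [Nat.choose_eq_zero_of_lt (by simpa using hk)]
      simp
  exact_mod_cast h2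

/-! ### Symmetry of the `h`-polynomials -/

theorem hCoeff_succ_zero (k : ℕ) : hCoeff (k + 1) 0 = 0 := by
  refine sum_eq_zero fun j _ => ?_
  cases j with
  | zero => simp
  | succ j => rw [partialSurjCount_eq_zero (Nat.succ_pos j), mul_zero]

/-- This is (a) at the coefficient of `x ^ l`, obtained from `hCoeff_succ_right` by `C(n, k) C(k, l)
= C(n, l) C(n - l, k - l)`. -/
theorem choose_mul_hCoeff_eq_sum {n l : ℕ} (hl : l < n) :
    n.choose l * hCoeff l (n - l) =
      ∑ k ∈ range n, n.choose k * (k.choose l * hCoeff (k - l) l) := by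
  obtain ⟨b, rfl⟩ : ∃ b, n = l + (b + 1) := ⟨n - l - 1, by omega⟩
  rw [Nat.add_sub_cancel_left, hCoeff_succ_right, mul_sum, sum_range_add _ l,
    sum_eq_zero (s := range l), zero_add]
  · refine sum_congr rfl fun i hi => ?_
    have hi' := mem_range.1 hi
    have h := Nat.choose_mul (n := l + (b + 1)) (k := l + i) (s := l) (Nat.le_add_right l i)
    rw [Nat.add_sub_cancel_left, Nat.add_sub_cancel_left] at h
    rw [Nat.add_sub_cancel_left, ← mul_assoc, ← mul_assoc, h]
  · intro k hk
    rw [Nat.choose_eq_zero_of_lt (mem_range.1 hk), zero_mul, mul_zero]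

open LaurentPolynomial in
theorem toLaurent_hA {n : ℕ} {N : ℕ} (h : n < N) :
    Polynomial.toLaurent (hA n) =
      ∑ k ∈ range N, ((n.choose k * hCoeff k (n - k) : ℕ) : LaurentPolynomial ℤ) * T (k : ℤ) := by
  have h1 : hA n = ∑ k ∈ range N,
      ((n.choose k * hCoeff k (n - k) : ℕ) : Polynomial ℤ) * Polynomial.X ^ k := by
    ext i
    simp only [Polynomial.finsetSum_coeff, Polynomial.coeff_natCast_mul, Polynomial.coeff_X_pow,
      mul_ite, mul_one, mul_zero, sum_ite_eq, coeff_hA]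
    split_ifs with hi
    · push_cast
      rfl
    · rw [Nat.choose_eq_zero_of_lt (by simp at hi; omega)]
      simp
  rw [h1, map_sum]
  simp

open LaurentPolynomial in
theorem toLaurent_hA_eq_sum {n : ℕ} (hn : 1 ≤ n) :
    Polynomial.toLaurent (hA n) = ∑ k ∈ range n, (n.choose k : LaurentPolynomial ℤ) *
      T (k : ℤ) * invert (Polynomial.toLaurent (hA k)) := by
  have h1 : ∀ k ∈ range n, (n.choose k : LaurentPolynomial ℤ) * T (k : ℤ) *
      invert (Polynomial.toLaurent (hA k)) = ∑ l ∈ range n,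
        ((n.choose k * (k.choose l * hCoeff (k - l) l) : ℕ) : LaurentPolynomial ℤ) * T (l : ℤ) := by
    intro k hk
    -- Reversing the sum collects the power `x ^ k * x ^ (-(k - l)) = x ^ l`.
    rw [toLaurent_hA (Nat.lt_succ_self k), ← sum_range_reflect, map_sum, mul_sum]
    refine (sum_congr rfl fun l hl => ?_).trans
      (sum_subset (range_subset_range.2 (mem_range.1 hk)) fun l _ hl => ?_)
    · have hl' : l ≤ k := Nat.lt_succ_iff.1 (mem_range.1 hl)
      have e : k + 1 - 1 - l = k - l := by omega
      have e2 : T (k : ℤ) * T (-((k - l : ℕ) : ℤ)) = (T (l : ℤ) : LaurentPolynomial ℤ) := by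
        rw [← T_add]
        congr 1
        omega
      simp only [Nat.succ_eq_add_one]
      rw [e, map_mul, map_natCast, invert_T, Nat.choose_symm hl', Nat.sub_sub_self hl', ← e2]
      push_cast
      ring
    · rw [Nat.choose_eq_zero_of_lt (show k < l by simpa using hl)]
      simp
  rw [sum_congr rfl h1, sum_comm, toLaurent_hA (Nat.lt_succ_self n), sum_range_succ]
  obtain ⟨m, rfl⟩ := Nat.exists_eq_add_of_le' hn
  -- The coefficient of `x ^ n` vanishes because `n` is positive.
  rw [Nat.sub_self, hCoeff_succ_zero]
  simp only [mul_zero, Nat.cast_zero, zero_mul, add_zero]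
  refine sum_congr rfl fun l hl => ?_
  rw [choose_mul_hCoeff_eq_sum (mem_range.1 hl), ← sum_mul, Nat.cast_sum]

/-! ### The Stirling number formula -/

theorem sum_Icc_stirlingSecond {n k : ℕ} (h : k ≤ n) :
    ∑ j ∈ Icc 1 (k + 1), (-1 : ℚ) ^ (k + 1 - j) * (j.factorial : ℚ) *
      (Nat.stirlingSecond (k + 1) j : ℚ) * (j : ℚ) ^ ((n : ℤ) - (k : ℤ) - 1) =
      hCoeff k (n - k) := by
  have h1 := congrArg (fun z : ℤ => (z : ℚ))
    (sum_neg_one_pow_mul_partialSurjCount_mul_pow k (n - k))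
  simp only [Int.cast_natCast] at h1
  rw [← h1, ← Ico_add_one_right_eq_Icc, sum_Ico_eq_sum_range]
  push_cast
  refine sum_congr rfl fun s _ => ?_
  have e : (n : ℤ) - k - 1 = ((n - k : ℕ) : ℤ) - 1 := by omega
  -- With `j = s + 1`, the factor `j` of `j!` cancels the `-1` in the exponent.
  rw [e, add_comm 1 s, Nat.add_sub_add_right, zpow_sub_one₀ (by positivity), zpow_natCast,
    partialSurjCount, Nat.factorial_succ]
  push_cast
  field_simp
  ring

end Antiprism

theorem mainTheorem7 :
    (∀ n : ℕ, 1 ≤ n →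
      Polynomial.toLaurent (Antiprism.hA n) =
        ∑ k ∈ Finset.range n, (n.choose k : LaurentPolynomial ℤ) * LaurentPolynomial.T (k : ℤ) *
          LaurentPolynomial.invert (Polynomial.toLaurent (Antiprism.hA k))) ∧
    (∀ n k : ℕ,
      (Antiprism.hA n).coeff k = ((Antiprism.properMultiPointed n k).ncard : ℤ) ∧
      (Antiprism.hA n).coeff k = ((Antiprism.colouredPartitions n k).ncard : ℤ) ∧
      (Antiprism.hA n).coeff k = ((Antiprism.halfUnionPartitions n k).ncard : ℤ) ∧
      (Antiprism.hA n).coeff k = (n.choose k : ℤ) * (Antiprism.excedanceCount n k : ℤ) ∧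
      ((Antiprism.hA n).coeff k : ℚ) = (n.choose k : ℚ) *
        ∑ j ∈ Finset.Icc 1 (k + 1), (-1 : ℚ) ^ (k + 1 - j) * (j.factorial : ℚ) *
          (Nat.stirlingSecond (k + 1) j : ℚ) * (j : ℚ) ^ ((n : ℤ) - (k : ℤ) - 1)) := by
  refine ⟨fun n hn => Antiprism.toLaurent_hA_eq_sum hn, fun n k => ?_⟩
  rw [Antiprism.ncard_properMultiPointed, Antiprism.ncard_colouredPartitions,
    Antiprism.ncard_halfUnionPartitions, Antiprism.coeff_hA]
  push_cast
  refine ⟨rfl, rfl, rfl, ?_⟩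
  rcases le_or_gt k n with h | h
  · obtain ⟨b, rfl⟩ := Nat.exists_eq_add_of_le h
    rw [Antiprism.excedanceCount_eq, Antiprism.sum_Icc_stirlingSecond h, Nat.add_sub_cancel_left]
    exact ⟨rfl, rfl⟩
  -- For `k > n` the binomial coefficient makes all expressions zero.
  · simp [Nat.choose_eq_zero_of_lt h]
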